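/- Let $\mathbb{B}^3=\{x\in\mathbb{R}^3:|x|<1\}$. For $\rho\in(0,1)$ put $$K(\rho)=\frac1{\rho^2}\left(\frac{(1+\frac13\rho^2)^{3/2}}{1-\rho^2}-1\right),$$ and put $K(0)=\lim_{\rho\to0}K(\rho)=\frac32$. Let $x\in\mathbb{B}^3$ and $\rho=|x|$. Then every bounded real-valued harmonic function $u$ on $\mathbb{B}^3$ satisfies $$|\nabla u(x)|\le K(\rho)\,\sup_{|y|<1}|u(y)|,$$ and the inequality is sharp: for each $x\in\mathbb{B}^3$, $K(|x|)$ is the smallest constant $C(x)$ for which $|\nabla u(x)|\le C(x)\sup_{|y|<1}|u(y)|$ holds for all bounded real-valued harmonic functions $u$ on $\mathbb{B}^3$. For a unit vector $l\in\mathbb{R}^3$ let $C(x,l)$ be the smallest constant for which $|\langle\nabla u(x),l\rangle|\le C(x,l)\sup_{|y|<1}|u(y)|$ holds for all such $u$, and for $x\ne0$ let $n_x=x/|x|$. Then, for $x\in\mathbb{B}^3\setminus\{0\}$, $C(x,l)\le C(x,n_x)$ for every unit vector $l$, and $C(x)=C(x,n_x)=K(|x|)$. -/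

import Mathlib

open InnerProductSpace

/-- `u` restricts to a bounded harmonic function on the open unit ball of `ℝⁿ`, i.e. an element
of the space `h^∞`. -/
def IsBoundedHarmonic {n : ℕ} (u : EuclideanSpace ℝ (Fin n) → ℝ) : Prop :=
  HarmonicOnNhd u (Metric.ball 0 1) ∧ ∃ M : ℝ, ∀ y ∈ Metric.ball 0 1, |u y| ≤ M

/-- `sup_{|y| < 1} |u y|`. It is only used for bounded harmonic functions, where the supremum is
over a nonempty set of reals that is bounded above. -/
noncomputable def supBall {n : ℕ} (u : EuclideanSpace ℝ (Fin n) → ℝ) : ℝ :=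
  ⨆ y : Metric.ball (0 : EuclideanSpace ℝ (Fin n)) 1, |u y|

/-- The constants `c` admissible in `|⟨∇u(x), l⟩| ≤ c · sup_{|y| < 1} |u y|`, for all bounded
harmonic functions `u` on the unit ball. -/
def directionalConstants {n : ℕ} (x l : EuclideanSpace ℝ (Fin n)) : Set ℝ :=
  {c | ∀ u : EuclideanSpace ℝ (Fin n) → ℝ, IsBoundedHarmonic u →
    |inner ℝ (gradient u x) l| ≤ c * supBall u}

/-- The constants `c` admissible in `|∇u(x)| ≤ c · sup_{|y| < 1} |u y|`, for all bounded
harmonic functions `u` on the unit ball. -/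
def gradientConstants {n : ℕ} (x : EuclideanSpace ℝ (Fin n)) : Set ℝ :=
  {c | ∀ u : EuclideanSpace ℝ (Fin n) → ℝ, IsBoundedHarmonic u →
    ‖gradient u x‖ ≤ c * supBall u}

/-- The optimal directional constant `C(x, l)`. -/
noncomputable def optimalDirectionalConstant {n : ℕ} (x l : EuclideanSpace ℝ (Fin n)) : ℝ :=
  sInf (directionalConstants x l)

/-- The optimal gradient constant `C(x)`. -/
noncomputable def optimalGradientConstant {n : ℕ} (x : EuclideanSpace ℝ (Fin n)) : ℝ :=
  sInf (gradientConstants x)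

/-- The radial direction `n_x = x / |x|`, for `x ≠ 0`. -/
noncomputable def radialDirection {n : ℕ} (x : EuclideanSpace ℝ (Fin n)) :
    EuclideanSpace ℝ (Fin n) :=
  ‖x‖⁻¹ • x

/-- The function `ρ ↦ ρ⁻² ((1 + ρ²/3)^(3/2) / (1 - ρ²) - 1)` on `[0, 1)`, with its limit value
`3/2` at `ρ = 0`. -/
noncomputable def khavinsonConstant (ρ : ℝ) : ℝ :=
  if ρ = 0 then 3 / 2
  else 1 / ρ ^ 2 * ((1 + ρ ^ 2 / 3) ^ (3 / 2 : ℝ) / (1 - ρ ^ 2) - 1)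

open Real Set MeasureTheory intervalIntegral

/-! The optimal constant in the direction `l` is the total variation `∫ |∂_l P(x, ζ)| dσ(ζ)` of the
differentiated Poisson kernel (`poissonVariation`). It is an upper bound by the Poisson formula
applied to dilates of `u` (`abs_fderiv_le_poissonVariation_supBall`), and the Poisson integral of
the sign of `∂_l P` attains it (`exists_isBoundedHarmonic_fderiv_eq`). What remains is to show that
the variation is largest in the radial direction and to evaluate it there.

Write `l = c n + s m` with `n` radial, `m ⟂ n` and `s ≥ 0`. Parametrize the sphere by the azimuth
`ψ` and by `q = (1 - ρ²) / |x - ζ|`. Up to a constant, `∂_l P dσ` becomes `(-c a(q) + s b(q) cos ψ)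
dq dψ` on `[1 - ρ, 1 + ρ] × [-π, π]` (`poissonVariation_eq_shell`). Integrating the absolute value
over `ψ` gives `4 s b Φ(c a / (s b))`, with `Φ` an even primitive of `arcsin`. With `k = |c| / s`
the variation is therefore proportional to `∫ b Φ(k a / b) dq / √(1 + k²)`.

This expression is nondecreasing in `k`, and its limit at `k = ∞` is the radial value
(`integral_abs_zonal_le`). Its `k`-derivative times `(1 + k²)^(3/2)` vanishes at `k = 0`, so
monotonicity follows once the derivative of that product, the integrated curvature, is nonnegative
(`integral_capCurvature_shell_nonneg`).

The substitution `q² = L + d cos φ` turns the curvature integral into an elliptic integral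
(`elliptic_integral_nonneg`). Modulo an exact derivative it is a sum of a square and a nonnegative
multiple of `∫ (-cos φ - β) / √(L + d cos φ)`. The latter is nonnegative by a Chebyshev correlation
argument together with a tangent line bound (`integral_neg_cos_div_sqrt_ge`). -/

/-! ### The elliptic integral inequality. -/

lemma integral_cos_pow_four_zero_pi : ∫ φ in (0:ℝ)..π, cos φ ^ 4 = 3 * π / 8 := by
  have h := integral_cos_pow (a := 0) (b := π) 2
  simp only [Nat.reduceAdd, integral_cos_sq] at h
  rw [h]; simp; ring

lemma integral_cos_sq_zero_pi : ∫ φ in (0:ℝ)..π, cos φ ^ 2 = π / 2 := by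
  rw [integral_cos_sq]; simp

lemma add_mul_cos_pos {L d : ℝ} (hd : 0 < d) (hL : d < L) (φ : ℝ) : 0 < L + d * cos φ := by
  nlinarith [neg_one_le_cos φ]

lemma sub_mul_cos_pos {L d : ℝ} (hd : 0 < d) (hL : d < L) (φ : ℝ) : 0 < L - d * cos φ := by
  nlinarith [cos_le_one φ]

lemma sq_sub_mul_pos {L d C : ℝ} (hd : 0 < d) (hL : d < L) (h1 : C ≤ 1) :
    0 < L ^ 2 - d ^ 2 * C := by
  nlinarith [sq_nonneg d, mul_le_mul_of_nonneg_left h1 (sq_nonneg d)]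

/-- The weight arising when the even and odd parts of `c ↦ (L + d c)^(-1/2)` are compared. -/
lemma pairing_identity {L d c : ℝ} (h1 : 0 < L + d * c) (h2 : 0 < L - d * c) (β : ℝ) :
    (-c - β) / √(L + d * c) + (c - β) / √(L - d * c) =
      √(2 * L / √(L ^ 2 - d ^ 2 * c ^ 2) ^ 2 + 2 / √(L ^ 2 - d ^ 2 * c ^ 2)) *
        (d * c ^ 2 / (L + √(L ^ 2 - d ^ 2 * c ^ 2)) - β) := by
  have hv : √(L ^ 2 - d ^ 2 * c ^ 2) = √(L + d * c) * √(L - d * c) := by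
    rw [← sqrt_mul h1.le]; ring_nf
  rw [hv]
  have hA := sqrt_pos.2 h1
  have hB := sqrt_pos.2 h2
  have hA2 := sq_sqrt h1.le
  have hB2 := sq_sqrt h2.le
  set A := √(L + d * c)
  set B := √(L - d * c)
  have hE : √(2 * L / (A * B) ^ 2 + 2 / (A * B)) = 1 / A + 1 / B := by
    rw [show 2 * L / (A * B) ^ 2 + 2 / (A * B) = (1 / A + 1 / B) ^ 2 by
      have : 2 * L = A ^ 2 + B ^ 2 := by rw [hA2, hB2]; ring
      rw [this]; field_simp; ring]
    exact sqrt_sq (by positivity)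
  rw [hE]
  have hL : 0 < L := by linarith
  -- Follows from `(A + B)² = 2 (L + A B)` and `A² - B² = 2 d c`.
  have hk : d * c ^ 2 / (L + A * B) = c * (A - B) / (A + B) := by
    have e1 : L = (A ^ 2 + B ^ 2) / 2 := by rw [hA2, hB2]; ring
    have e2 : d * c = (A ^ 2 - B ^ 2) / 2 := by rw [hA2, hB2]; ring
    rw [div_eq_div_iff (by positivity) (by positivity)]
    rw [show d * c ^ 2 * (A + B) = (d * c) * c * (A + B) by ring, e2]
    rw [e1]
    ring
  rw [hk]
  field_simp
  ring

/-- The function `w ↦ 1 / (L + √w)` is convex; the left side is its tangent at `w = v₀²`, taken at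
`w = v²`. -/
lemma inv_add_tangent {L v v₀ : ℝ} (hL : 0 < L) (hv : 0 < v) (hv₀ : 0 < v₀) :
    1 / (L + v₀) + (v₀ ^ 2 - v ^ 2) / (2 * v₀ * (L + v₀) ^ 2) ≤ 1 / (L + v) := by
  have : 1 / (L + v) - (1 / (L + v₀) + (v₀ ^ 2 - v ^ 2) / (2 * v₀ * (L + v₀) ^ 2)) =
      (v₀ - v) ^ 2 * (L + 2 * v₀ + v) / ((L + v) * (2 * v₀ * (L + v₀) ^ 2)) := by
    field_simp
    ring
  have h2 : 0 ≤ (v₀ - v) ^ 2 * (L + 2 * v₀ + v) / ((L + v) * (2 * v₀ * (L + v₀) ^ 2)) := by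
    positivity
  linarith

/-- Chebyshev's correlation inequality combined with a tangent line bound. -/
lemma integral_neg_cos_div_sqrt_ge {L d : ℝ} (hd : 0 < d) (hL : d < L) :
    0 ≤ ∫ φ in (0:ℝ)..π,
      (-cos φ - d / (2 * (L + √(L ^ 2 - d ^ 2 * (3 / 4))))) / √(L + d * cos φ) := by
  set v₀ := √(L ^ 2 - d ^ 2 * (3 / 4)) with hv₀def
  set β := d / (2 * (L + v₀)) with hβ
  have hL0 : 0 < L := hd.trans hL
  have hv₀ : 0 < v₀ := sqrt_pos.2 (sq_sub_mul_pos hd hL (by norm_num))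
  have hv₀2 : v₀ ^ 2 = L ^ 2 - d ^ 2 * (3 / 4) :=
    sq_sqrt (sq_sub_mul_pos hd hL (by norm_num)).le
  have hsA : ∀ φ, √(L + d * cos φ) ≠ 0 := fun φ => (sqrt_pos.2 (add_mul_cos_pos hd hL φ)).ne'
  have hsB : ∀ φ, √(L - d * cos φ) ≠ 0 := fun φ => (sqrt_pos.2 (sub_mul_cos_pos hd hL φ)).ne'
  -- Reflecting `φ ↦ π - φ` lets the integrands at `c` and `-c` be added, so that everything depends
  -- on `C = cos² φ` only.
  have hsym : ∫ φ in (0:ℝ)..π, (-cos φ - β) / √(L + d * cos φ) =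
      ∫ φ in (0:ℝ)..π, (cos φ - β) / √(L - d * cos φ) := by
    have := intervalIntegral.integral_comp_sub_left (a := 0) (b := π)
      (fun φ => (-cos φ - β) / √(L + d * cos φ)) π
    simp only [sub_self, sub_zero, cos_pi_sub, neg_neg] at this
    rw [← this]
    congr 1; ext φ; ring_nf
  have hcA : Continuous fun φ => (-cos φ - β) / √(L + d * cos φ) :=
    Continuous.div (by fun_prop) (by fun_prop) hsA
  have hcB : Continuous fun φ => (cos φ - β) / √(L - d * cos φ) :=
    Continuous.div (by fun_prop) (by fun_prop) hsB
  let V : ℝ → ℝ := fun C => √(L ^ 2 - d ^ 2 * C)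
  let H : ℝ → ℝ := fun C => d * C / (L + V C)
  let E : ℝ → ℝ := fun C => √(2 * L / V C ^ 2 + 2 / V C)
  have hVpos : ∀ C ≤ 1, 0 < V C := fun C h1 => sqrt_pos.2 (sq_sub_mul_pos hd hL h1)
  have hVanti : ∀ C D, C ≤ D → V D ≤ V C := fun C D h => sqrt_le_sqrt (by nlinarith [sq_nonneg d])
  have hHc : Continuous H := by
    refine Continuous.div (by fun_prop) (by fun_prop) fun C => ?_
    have : 0 ≤ V C := sqrt_nonneg _
    positivity
  have hHmono : ∀ C D, 0 ≤ C → C ≤ D → H C ≤ H D := by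
    intro C D h0 h
    have : 0 ≤ V D := sqrt_nonneg _
    have := hVanti C D h
    have : 0 ≤ d * D := mul_nonneg hd.le (h0.trans h)
    simp only [H]
    gcongr
  have hEmono : ∀ C D, C ≤ D → D ≤ 1 → E C ≤ E D := by
    intro C D h h1
    have := hVpos D h1
    have := hVanti C D h
    simp only [E]
    apply sqrt_le_sqrt
    gcongr
  -- `H - β` changes sign at `Cs` and the weight `E` is increasing, so `E` may be frozen at `Cs` at
  -- the cost of an inequality in the right direction.
  obtain ⟨Cs, hCs, hroot⟩ : ∃ C ∈ Icc (0:ℝ) 1, H C = β := by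
    have := intermediate_value_Icc (zero_le_one (α := ℝ)) hHc.continuousOn
    apply this
    constructor
    · simp only [H, mul_zero, zero_div]; positivity
    · simp only [H, hβ, mul_one]
      have : V 1 ≤ L := by
        have : V 1 ≤ √(L ^ 2) := sqrt_le_sqrt (by nlinarith [sq_nonneg d])
        rwa [sqrt_sq hL0.le] at this
      have := hVpos 1 le_rfl
      gcongr
      linarith
  have hpt : ∀ φ, E Cs * (d * cos φ ^ 2 * (1 / (L + v₀) +
        d ^ 2 * (cos φ ^ 2 - 3 / 4) / (2 * v₀ * (L + v₀) ^ 2)) - β) ≤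
      (-cos φ - β) / √(L + d * cos φ) + (cos φ - β) / √(L - d * cos φ) := by
    intro φ
    rw [pairing_identity (add_mul_cos_pos hd hL φ) (sub_mul_cos_pos hd hL φ)]
    set C := cos φ ^ 2 with hC
    have hC0 : 0 ≤ C := sq_nonneg _
    have hC1 : C ≤ 1 := cos_sq_le_one φ
    change _ ≤ E C * (H C - β)
    have h1 : E Cs * (H C - β) ≤ E C * (H C - β) := by
      rcases le_total Cs C with h | h
      · have := hEmono _ _ h hC1
        have := hHmono _ _ hCs.1 h
        apply mul_le_mul_of_nonneg_right <;> linarith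
      · have := hEmono _ _ h hCs.2
        have := hHmono _ _ hC0 h
        apply mul_le_mul_of_nonpos_right <;> linarith
    refine le_trans ?_ h1
    have hE0 : 0 ≤ E Cs := sqrt_nonneg _
    apply mul_le_mul_of_nonneg_left _ hE0
    have h2 := inv_add_tangent hL0 (hVpos C hC1) hv₀
    have h3 : V C ^ 2 = L ^ 2 - d ^ 2 * C := sq_sqrt (sq_sub_mul_pos hd hL hC1).le
    rw [h3, hv₀2, show L ^ 2 - d ^ 2 * (3 / 4) - (L ^ 2 - d ^ 2 * C) = d ^ 2 * (C - 3 / 4) by ring]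
      at h2
    have h4 := mul_le_mul_of_nonneg_left h2 (by positivity : 0 ≤ d * C)
    have h5 : d * C * (1 / (L + V C)) = H C := by simp only [H]; ring
    rw [h5] at h4
    linarith
  -- The base point `3/4` is `∫ cos⁴ / ∫ cos²`, so the linear correction integrates to zero; `β` is
  -- the mean of `d cos² φ / (L + v₀)`.
  have hI : ∫ φ in (0:ℝ)..π, E Cs * (d * cos φ ^ 2 * (1 / (L + v₀) +
        d ^ 2 * (cos φ ^ 2 - 3 / 4) / (2 * v₀ * (L + v₀) ^ 2)) - β) = 0 := by
    rw [intervalIntegral.integral_const_mul]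
    have e : ∀ φ, d * cos φ ^ 2 * (1 / (L + v₀) +
        d ^ 2 * (cos φ ^ 2 - 3 / 4) / (2 * v₀ * (L + v₀) ^ 2)) - β =
        (d / (L + v₀) - 3 / 4 * (d ^ 3 / (2 * v₀ * (L + v₀) ^ 2))) * cos φ ^ 2 +
        (d ^ 3 / (2 * v₀ * (L + v₀) ^ 2)) * cos φ ^ 4 - β := by
      intro φ; field_simp; ring
    simp only [e]
    rw [intervalIntegral.integral_sub, intervalIntegral.integral_add,
      intervalIntegral.integral_const_mul, intervalIntegral.integral_const_mul,
      integral_cos_pow_four_zero_pi, integral_cos_sq_zero_pi, intervalIntegral.integral_const]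
    · simp only [hβ, sub_zero, smul_eq_mul, mul_eq_zero]; right; field_simp; ring
    all_goals exact Continuous.intervalIntegrable (by fun_prop) _ _
  have hfin : ∫ φ in (0:ℝ)..π, E Cs * (d * cos φ ^ 2 * (1 / (L + v₀) +
        d ^ 2 * (cos φ ^ 2 - 3 / 4) / (2 * v₀ * (L + v₀) ^ 2)) - β) ≤
      ∫ φ in (0:ℝ)..π, ((-cos φ - β) / √(L + d * cos φ) + (cos φ - β) / √(L - d * cos φ)) :=
    intervalIntegral.integral_mono_on pi_pos.le
      (Continuous.intervalIntegrable (by fun_prop) _ _)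
      ((hcA.add hcB).intervalIntegrable _ _) fun φ _ => hpt φ
  rw [hI, intervalIntegral.integral_add (hcA.intervalIntegrable _ _) (hcB.intervalIntegrable _ _),
    ← hsym] at hfin
  linarith

/-- The integrand is the derivative of `sin φ √(L + d cos φ)`. The relation serves to eliminate the
`cos²` term from the elliptic integral. -/
lemma integral_sin_mul_sqrt_deriv {L d : ℝ} (hd : 0 < d) (hL : d < L) :
    ∫ φ in (0:ℝ)..π, (L * cos φ + d * cos φ ^ 2 - d / 2 * sin φ ^ 2) / √(L + d * cos φ) = 0 := by
  have hsA : ∀ φ, √(L + d * cos φ) ≠ 0 := fun φ => (sqrt_pos.2 (add_mul_cos_pos hd hL φ)).ne'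
  have hder : ∀ φ, HasDerivAt (fun φ => sin φ * √(L + d * cos φ))
      ((L * cos φ + d * cos φ ^ 2 - d / 2 * sin φ ^ 2) / √(L + d * cos φ)) φ := by
    intro φ
    have h1 : HasDerivAt (fun φ => L + d * cos φ) (d * -sin φ) φ :=
      ((hasDerivAt_cos φ).const_mul d).const_add L
    have h2 := (hasDerivAt_sin φ).mul (h1.sqrt (add_mul_cos_pos hd hL φ).ne')
    refine h2.congr_deriv ?_
    have h3 := sq_sqrt (add_mul_cos_pos hd hL φ).le
    have := hsA φ
    set S := √(L + d * cos φ)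
    field_simp
    rw [h3]; ring
  rw [intervalIntegral.integral_eq_sub_of_hasDerivAt (fun φ _ => hder φ)]
  · simp
  · exact (Continuous.div (by fun_prop) (by fun_prop) hsA).intervalIntegrable _ _

lemma elliptic_integral_nonneg {L d e : ℝ} (hd : 0 < d) (hL : d < L) (he : e ≤ 2 / 3 * L) :
    0 ≤ ∫ φ in (0:ℝ)..π,
      ((e + d * cos φ) ^ 2 - d ^ 2 * sin φ ^ 2) / √(L + d * cos φ) := by
  have hsA : ∀ φ, √(L + d * cos φ) ≠ 0 := fun φ => (sqrt_pos.2 (add_mul_cos_pos hd hL φ)).ne'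
  have h1 := integral_neg_cos_div_sqrt_ge hd hL
  have h2 := integral_sin_mul_sqrt_deriv hd hL
  set v₀ := √(L ^ 2 - d ^ 2 * (3 / 4)) with hv₀def
  set β := d / (2 * (L + v₀)) with hβ
  have hL0 : 0 < L := hd.trans hL
  have hv₀ : 0 < v₀ := sqrt_pos.2 (sq_sub_mul_pos hd hL (by norm_num))
  have hv₀2 : v₀ ^ 2 = L ^ 2 - d ^ 2 * (3 / 4) :=
    sq_sqrt (sq_sub_mul_pos hd hL (by norm_num)).le
  -- `β` is a root of `d β² - (4/3) L β + d / 3 = 0`. With this choice the constant left over after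
  -- removing the exact part and the `(-cos φ - β)` part is exactly `(e - d β)²`.
  have hβ2 : 4 / 3 * L * β - d / 3 = d * β ^ 2 := by
    rw [hβ]; field_simp; nlinarith [hv₀2]
  clear_value β v₀
  have hm : 0 ≤ ∫ φ in (0:ℝ)..π, 1 / √(L + d * cos φ) :=
    intervalIntegral.integral_nonneg pi_pos.le fun φ _ => by positivity
  have key : ∫ φ in (0:ℝ)..π, ((e + d * cos φ) ^ 2 - d ^ 2 * sin φ ^ 2) / √(L + d * cos φ) =
      (e - d * β) ^ 2 * (∫ φ in (0:ℝ)..π, 1 / √(L + d * cos φ)) +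
      (4 / 3 * L - 2 * e) * d * (∫ φ in (0:ℝ)..π, (-cos φ - β) / √(L + d * cos φ)) +
      4 / 3 * d * ∫ φ in (0:ℝ)..π,
        (L * cos φ + d * cos φ ^ 2 - d / 2 * sin φ ^ 2) / √(L + d * cos φ) := by
    rw [← intervalIntegral.integral_const_mul, ← intervalIntegral.integral_const_mul,
      ← intervalIntegral.integral_const_mul, ← intervalIntegral.integral_add,
      ← intervalIntegral.integral_add]
    · congr 1; ext φ
      have := hsA φ
      field_simp
      have hs : sin φ ^ 2 = 1 - cos φ ^ 2 := sin_sq φ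
      rw [hs]
      have : d * β ^ 2 * d = d * (4 / 3 * L * β - d / 3) := by rw [hβ2]; ring
      linear_combination (-6) * this
    all_goals
      refine Continuous.intervalIntegrable ?_ _ _
      first
        | exact Continuous.mul (by fun_prop) (Continuous.div (by fun_prop) (by fun_prop) hsA)
        | exact Continuous.add
            (Continuous.mul (by fun_prop) (Continuous.div (by fun_prop) (by fun_prop) hsA))
            (Continuous.mul (by fun_prop) (Continuous.div (by fun_prop) (by fun_prop) hsA))
  rw [key, h2, mul_zero, add_zero]
  have : 0 ≤ (4 / 3 * L - 2 * e) * d := mul_nonneg (by linarith) hd.le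
  positivity

/-! ### The primitive of `arcsin`, circle averages, slope and curvature. -/

/-- The primitive of `arcsin`. -/
noncomputable def arcsinPrimitive (x : ℝ) : ℝ := √(1 - x ^ 2) + x * arcsin x

lemma arcsinPrimitive_neg (x : ℝ) : arcsinPrimitive (-x) = arcsinPrimitive x := by
  simp [arcsinPrimitive, arcsin_neg]

lemma continuous_arcsinPrimitive : Continuous arcsinPrimitive := by
  unfold arcsinPrimitive
  have := continuous_arcsin
  fun_prop

lemma abs_arcsin_le (x : ℝ) : |arcsin x| ≤ π / 2 :=
  abs_le.2 ⟨neg_pi_div_two_le_arcsin x, arcsin_le_pi_div_two x⟩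

lemma arcsinPrimitive_nonneg (x : ℝ) : 0 ≤ arcsinPrimitive x := by
  have : 0 ≤ x * arcsin x := by
    rcases le_total 0 x with h | h
    · exact mul_nonneg h (arcsin_nonneg.2 h)
    · exact mul_nonneg_of_nonpos_of_nonpos h (arcsin_nonpos.2 h)
  have := sqrt_nonneg (1 - x ^ 2)
  unfold arcsinPrimitive
  linarith

lemma arcsinPrimitive_le (x : ℝ) : arcsinPrimitive x ≤ 1 + |x| * (π / 2) := by
  have h1 : √(1 - x ^ 2) ≤ 1 := sqrt_le_one.2 (by nlinarith [sq_nonneg x])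
  have h2 : x * arcsin x ≤ |x| * (π / 2) :=
    (le_abs_self _).trans (by rw [abs_mul]; gcongr; exact abs_arcsin_le x)
  unfold arcsinPrimitive
  linarith

/-- For `x² > 1` the root is locally constant `0` and the quotient is `0` by division by zero, so
one formula serves on both sides of `±1`. The same happens for the clamped `arcsin`, which leaves
only countably many exceptional points below. -/
lemma hasDerivAt_sqrt_one_sub_sq {x : ℝ} (h : x ^ 2 ≠ 1) :
    HasDerivAt (fun x => √(1 - x ^ 2)) (-x / √(1 - x ^ 2)) x := by
  have h1 : HasDerivAt (fun x : ℝ => 1 - x ^ 2) (-(2 * x)) x := by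
    simpa using (hasDerivAt_pow 2 x).const_sub 1
  refine (h1.sqrt (sub_ne_zero.2 h.symm)).congr_deriv ?_
  rw [neg_div, mul_div_mul_left _ _ two_ne_zero, neg_div]

lemma hasDerivAt_arcsin_of_sq_ne {x : ℝ} (h : x ^ 2 ≠ 1) :
    HasDerivAt arcsin (1 / √(1 - x ^ 2)) x :=
  hasDerivAt_arcsin (by rintro rfl; norm_num at h) (by rintro rfl; norm_num at h)

lemma hasDerivAt_arcsinPrimitive {x : ℝ} (h : x ^ 2 ≠ 1) :
    HasDerivAt arcsinPrimitive (arcsin x) x := by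
  refine ((hasDerivAt_sqrt_one_sub_sq h).add
    ((hasDerivAt_id x).mul (hasDerivAt_arcsin_of_sq_ne h))).congr_deriv ?_
  simp; ring

/-- If `|a| < b` the integrand changes sign at `arccos (-a / b)`. If `|a| ≥ b` its sign is constant,
and the clamped `arcsin` and the vanishing root give `arcsinPrimitive x = |x| π / 2`, which is again
the correct value. -/
lemma integral_abs_add_mul_cos {a b : ℝ} (hb : 0 < b) :
    ∫ ψ in (-π)..π, |a + b * cos ψ| = 4 * (b * arcsinPrimitive (a / b)) := by
  have hc : Continuous fun ψ => |a + b * cos ψ| := by fun_prop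
  have hc' : Continuous fun ψ => a + b * cos ψ := by fun_prop
  have hF : ∀ u v, ∫ ψ in u..v, (a + b * cos ψ) = a * (v - u) + b * (sin v - sin u) := by
    intro u v
    rw [intervalIntegral.integral_add (Continuous.intervalIntegrable (by fun_prop) _ _)
      (Continuous.intervalIntegrable (by fun_prop) _ _), intervalIntegral.integral_const,
      intervalIntegral.integral_const_mul, integral_cos, smul_eq_mul]
    ring
  have heven : ∫ ψ in (-π)..π, |a + b * cos ψ| = 2 * ∫ ψ in (0:ℝ)..π, |a + b * cos ψ| := by
    have h := intervalIntegral.integral_comp_neg (a := 0) (b := π) fun ψ => |a + b * cos ψ|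
    simp only [cos_neg, neg_zero] at h
    rw [← integral_add_adjacent_intervals (hc.intervalIntegrable _ 0)
      (hc.intervalIntegrable 0 _), ← h]
    ring
  rw [heven]
  rcases le_or_gt b a with h1 | h1
  · have : ∀ ψ, |a + b * cos ψ| = a + b * cos ψ := fun ψ =>
      abs_of_nonneg (by nlinarith [neg_one_le_cos ψ])
    simp only [this, hF]
    have hab : 1 ≤ a / b := (one_le_div hb).2 h1
    rw [arcsinPrimitive, arcsin_of_one_le hab, sqrt_eq_zero_of_nonpos (by nlinarith)]
    simp; field_simp; ring
  rcases le_or_gt a (-b) with h2 | h2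
  · have : ∀ ψ, |a + b * cos ψ| = -(a + b * cos ψ) := fun ψ =>
      abs_of_nonpos (by nlinarith [cos_le_one ψ])
    simp only [this, intervalIntegral.integral_neg, hF]
    have hab : a / b ≤ -1 := (div_le_iff₀ hb).2 (by linarith)
    rw [arcsinPrimitive, arcsin_of_le_neg_one hab, sqrt_eq_zero_of_nonpos (by nlinarith)]
    simp; field_simp; ring
  · have hx1 : -1 ≤ -(a / b) := by rw [← neg_div, le_div_iff₀ hb]; linarith
    have hx2 : -(a / b) ≤ 1 := by rw [← neg_div, div_le_iff₀ hb]; linarith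
    set ψ₀ := arccos (-(a / b)) with hψ
    have hcos : cos ψ₀ = -(a / b) := cos_arccos hx1 hx2
    have hab : a = -(b * cos ψ₀) := by rw [hcos]; field_simp
    rw [← integral_add_adjacent_intervals (hc.intervalIntegrable _ ψ₀)
      (hc.intervalIntegrable ψ₀ _)]
    have e1 : ∫ ψ in (0:ℝ)..ψ₀, |a + b * cos ψ| = ∫ ψ in (0:ℝ)..ψ₀, (a + b * cos ψ) := by
      apply intervalIntegral.integral_congr
      intro ψ hm
      rw [uIcc_of_le (arccos_nonneg _)] at hm
      have := cos_le_cos_of_nonneg_of_le_pi hm.1 (arccos_le_pi _) hm.2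
      exact abs_of_nonneg (by rw [hab]; nlinarith)
    have e2 : ∫ ψ in ψ₀..π, |a + b * cos ψ| = ∫ ψ in ψ₀..π, -(a + b * cos ψ) := by
      apply intervalIntegral.integral_congr
      intro ψ hm
      rw [uIcc_of_le (arccos_le_pi _)] at hm
      have := cos_le_cos_of_nonneg_of_le_pi (arccos_nonneg _) hm.2 hm.1
      exact abs_of_nonpos (by rw [hab]; nlinarith)
    rw [e1, e2, intervalIntegral.integral_neg, hF, hF, hψ, sin_arccos, arccos_neg,
      arccos, sin_zero, sin_pi, arcsinPrimitive]
    have hb' := hb.ne'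
    simp only [neg_sq]
    field_simp
    ring

/-- The derivative of `k ↦ arcsinPrimitive (k * r) / √(1 + k ^ 2)` times `√(1 + k ^ 2) ^ 3`. -/
noncomputable def capSlope (r k : ℝ) : ℝ := r * arcsin (k * r) - k * √(1 - (k * r) ^ 2)

/-- The derivative of `capSlope r`. -/
noncomputable def capCurvature (r k : ℝ) : ℝ :=
  ((1 + 2 * k ^ 2) * r ^ 2 - 1) / √(1 - (k * r) ^ 2)

/-- The exceptional set in the applications of the fundamental theorem of calculus in `k`. -/
lemma countable_mul_sq_eq_one (r : ℝ) : {k : ℝ | (k * r) ^ 2 = 1}.Countable := by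
  refine ((Set.countable_singleton (1 / r)).union (Set.countable_singleton (-1 / r))).mono ?_
  intro k hk
  have hk' : (k * r) ^ 2 = 1 := hk
  have hr : r ≠ 0 := by rintro rfl; simp at hk'
  rcases (sq_eq_sq_iff_eq_or_eq_neg.1 (hk'.trans (one_pow 2).symm)) with h | h
  · left; exact (eq_div_iff hr).2 h
  · right; exact (eq_div_iff hr).2 h

lemma hasDerivAt_capSlope {r k : ℝ} (h : (k * r) ^ 2 ≠ 1) :
    HasDerivAt (capSlope r) (capCurvature r k) k := by
  have hm : HasDerivAt (fun k => k * r) r k := by simpa using (hasDerivAt_id k).mul_const r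
  have h1 := ((hasDerivAt_arcsin_of_sq_ne h).comp k hm).const_mul r
  have h2 := (hasDerivAt_id k).mul ((hasDerivAt_sqrt_one_sub_sq h).comp k hm)
  refine (h1.sub h2).congr_deriv ?_
  simp only [capCurvature, id, one_mul, Function.comp]
  rcases lt_or_gt_of_ne h with h | h
  · have hp : 0 < 1 - (k * r) ^ 2 := by linarith
    have hs := sq_sqrt hp.le
    have := (sqrt_pos.2 hp).ne'
    set S := √(1 - (k * r) ^ 2)
    field_simp
    rw [hs]; ring
  · rw [sqrt_eq_zero_of_nonpos (by linarith)]; simp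

lemma continuous_capSlope (r : ℝ) : Continuous (capSlope r) := by
  unfold capSlope
  have := continuous_arcsin
  fun_prop

lemma hasDerivAt_arcsinPrimitive_div {r k : ℝ} (h : (k * r) ^ 2 ≠ 1) :
    HasDerivAt (fun k => arcsinPrimitive (k * r) / √(1 + k ^ 2))
      (capSlope r k / √(1 + k ^ 2) ^ 3) k := by
  have hm : HasDerivAt (fun k => k * r) r k := by simpa using (hasDerivAt_id k).mul_const r
  have hp : 0 < 1 + k ^ 2 := by positivity
  have hq : HasDerivAt (fun k : ℝ => 1 + k ^ 2) (2 * k) k := by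
    simpa using (hasDerivAt_pow 2 k).const_add 1
  have h1 := ((hasDerivAt_arcsinPrimitive h).comp k hm).div (hq.sqrt hp.ne') (sqrt_pos.2 hp).ne'
  refine h1.congr_deriv ?_
  simp only [Function.comp, capSlope, arcsinPrimitive]
  have hs := sq_sqrt hp.le
  have := (sqrt_pos.2 hp).ne'
  set S := √(1 + k ^ 2)
  field_simp
  rw [hs]; ring

/-- The integrand is the derivative of the bounded monotone function `j ↦ r arcsin (j r)`. The bound
is linear in `|r|`; with `r = a / b` and a factor `b` it stays bounded where `b` degenerates. -/
lemma integrableOn_sq_div_sqrt (r : ℝ) {k : ℝ} (hk : 0 ≤ k) :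
    IntegrableOn (fun j => r ^ 2 / √(1 - (j * r) ^ 2)) (Ioc 0 k) ∧
    ∫ j in Ioc 0 k, r ^ 2 / √(1 - (j * r) ^ 2) ≤ |r| * (π / 2) := by
  have hcont : Continuous fun j => |r| * arcsin (j * |r|) := by
    have := continuous_arcsin
    fun_prop
  have hint : IntegrableOn (fun j => r ^ 2 / √(1 - (j * r) ^ 2)) (Ioc 0 k) := by
    -- A right derivative suffices here, and for `arcsin` it exists also at `1`, so the singular
    -- point `j |r| = 1` needs no exception.
    refine integrableOn_deriv_right_of_nonneg hcont.continuousOn ?_ fun j _ => by positivity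
    intro j hj
    have h0 : 0 ≤ j * |r| := mul_nonneg hj.1.le (abs_nonneg r)
    have h1 := hasDerivWithinAt_arcsin_Ici (x := j * |r|) (by linarith)
    have hm : HasDerivWithinAt (fun j => j * |r|) |r| (Ioi j) j := by
      simpa using ((hasDerivAt_id j).mul_const |r|).hasDerivWithinAt
    have h2 := (h1.comp j hm (fun i hi =>
      mul_le_mul_of_nonneg_right (le_of_lt hi) (abs_nonneg r))).const_mul |r|
    refine h2.congr_deriv ?_
    rw [mul_pow, sq_abs, ← mul_pow, ← sq_abs r]; ring
  refine ⟨hint, ?_⟩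
  rw [← intervalIntegral.integral_of_le hk,
    MeasureTheory.integral_eq_of_hasDerivAt_off_countable (fun j => r * arcsin (j * r)) _
      (countable_mul_sq_eq_one r)]
  · simp only [zero_mul, arcsin_zero, mul_zero, sub_zero]
    refine (le_abs_self _).trans ?_
    rw [abs_mul]; gcongr; exact abs_arcsin_le _
  · have := continuous_arcsin
    fun_prop
  · intro j hj
    have hm : HasDerivAt (fun k => k * r) r j := by simpa using (hasDerivAt_id j).mul_const r
    refine (((hasDerivAt_arcsin_of_sq_ne hj.2).comp j hm).const_mul r).congr_deriv ?_
    ring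
  · exact (intervalIntegrable_iff_integrableOn_Ioc_of_le hk).2 hint

/-- With `S = √(1 - (j r)²) > 0` the curvature equals `(1 + j²) r² / S - S`, and `S ≤ 1`; elsewhere
it is `0` by division by zero. -/
lemma abs_capCurvature_le {r k j : ℝ} (hj : 0 ≤ j) (hjk : j ≤ k) :
    |capCurvature r j| ≤ 1 + (1 + k ^ 2) * (r ^ 2 / √(1 - (j * r) ^ 2)) := by
  unfold capCurvature
  rcases le_or_gt (1 - (j * r) ^ 2) 0 with h | h
  · rw [sqrt_eq_zero_of_nonpos h]; simp
  · have hs := sq_sqrt h.le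
    have hs0 := sqrt_pos.2 h
    have hs1 : √(1 - (j * r) ^ 2) ≤ 1 := sqrt_le_one.2 (by nlinarith [sq_nonneg (j * r)])
    set S := √(1 - (j * r) ^ 2)
    have e : ((1 + 2 * j ^ 2) * r ^ 2 - 1) / S = (1 + j ^ 2) * (r ^ 2 / S) - S := by
      field_simp
      rw [hs]; ring
    rw [e, abs_le]
    have h1 : (1 + j ^ 2) * (r ^ 2 / S) ≤ (1 + k ^ 2) * (r ^ 2 / S) := by gcongr
    have h2 : 0 ≤ (1 + j ^ 2) * (r ^ 2 / S) := by positivity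
    constructor <;> linarith

lemma integral_capCurvature (r : ℝ) {k : ℝ} (hk : 0 ≤ k) :
    IntegrableOn (capCurvature r) (Ioc 0 k) ∧
      ∫ j in Ioc 0 k, capCurvature r j = capSlope r k := by
  have hmeas : Measurable (capCurvature r) := by unfold capCurvature; fun_prop
  have hint : IntegrableOn (capCurvature r) (Ioc 0 k) := by
    have h1 : IntegrableOn (fun j => 1 + (1 + k ^ 2) * (r ^ 2 / √(1 - (j * r) ^ 2)))
        (Ioc 0 k) :=
      Integrable.add (integrable_const _) ((integrableOn_sq_div_sqrt r hk).1.const_mul _)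
    refine Integrable.mono' h1 hmeas.aestronglyMeasurable ?_
    filter_upwards [ae_restrict_mem measurableSet_Ioc] with j hj
    exact abs_capCurvature_le hj.1.le hj.2
  refine ⟨hint, ?_⟩
  rw [← intervalIntegral.integral_of_le hk,
    MeasureTheory.integral_eq_of_hasDerivAt_off_countable (capSlope r) _
      (countable_mul_sq_eq_one r)]
  · simp [capSlope]
  · exact (continuous_capSlope r).continuousOn
  · exact fun j hj => hasDerivAt_capSlope hj.2
  · exact (intervalIntegrable_iff_integrableOn_Ioc_of_le hk).2 hint

/-! ### Reduction of the comparison of directions to the sign of the integrated curvature. -/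

section ZonalAverages

variable {μ : Measure ℝ} [IsFiniteMeasure μ] {a b : ℝ → ℝ} {C : ℝ}

lemma measurable_capCurvature_uncurry (ha : Measurable a) (hb : Measurable b) :
    Measurable (Function.uncurry fun q j => b q * capCurvature (a q / b q) j) := by
  unfold capCurvature Function.uncurry
  fun_prop

/-- The integral over `j` is at most `b k + (1 + k²) |a| π / 2`, which is bounded although `a / b`
need not be; this legitimates Fubini. -/
lemma integrable_capCurvature_prod (ha : Measurable a) (hb : Measurable b)
    (hab : ∀ᵐ q ∂μ, 0 < b q ∧ b q ≤ C ∧ |a q| ≤ C) {k : ℝ} (hk : 0 ≤ k) :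
    Integrable (Function.uncurry fun q j => b q * capCurvature (a q / b q) j)
      (μ.prod (volume.restrict (Ioc 0 k))) := by
  have hm := measurable_capCurvature_uncurry ha hb
  have hsm : AEStronglyMeasurable _ (μ.prod (volume.restrict (Ioc 0 k))) :=
    hm.aestronglyMeasurable
  rw [integrable_prod_iff hsm]
  refine ⟨Filter.Eventually.of_forall fun q =>
    (integral_capCurvature (a q / b q) hk).1.const_mul (b q), ?_⟩
  refine Integrable.mono' (integrable_const (C * k + (1 + k ^ 2) * (C * (π / 2))))
    hsm.norm.integral_prod_right' ?_
  filter_upwards [hab] with q ⟨h0, h1, h2⟩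
  rw [norm_of_nonneg (integral_nonneg fun _ => norm_nonneg _)]
  have hi := integrableOn_sq_div_sqrt (a q / b q) hk
  have hb1 : ∀ j ∈ Ioc 0 k, ‖b q * capCurvature (a q / b q) j‖ ≤
      b q * (1 + (1 + k ^ 2) * ((a q / b q) ^ 2 / √(1 - (j * (a q / b q)) ^ 2))) := by
    intro j hj
    rw [norm_mul, norm_of_nonneg h0.le]
    exact mul_le_mul_of_nonneg_left (abs_capCurvature_le hj.1.le hj.2) h0.le
  have hI : IntegrableOn (fun j =>
      b q * (1 + (1 + k ^ 2) * ((a q / b q) ^ 2 / √(1 - (j * (a q / b q)) ^ 2)))) (Ioc 0 k) :=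
    (Integrable.add (integrable_const _) (hi.1.const_mul _)).const_mul _
  calc ∫ j in Ioc 0 k, ‖b q * capCurvature (a q / b q) j‖
      ≤ ∫ j in Ioc 0 k,
        b q * (1 + (1 + k ^ 2) * ((a q / b q) ^ 2 / √(1 - (j * (a q / b q)) ^ 2))) :=
        setIntegral_mono_on ((integral_capCurvature (a q / b q) hk).1.const_mul (b q)).norm hI
          measurableSet_Ioc hb1
    _ = b q * (k + (1 + k ^ 2) *
        ∫ j in Ioc 0 k, (a q / b q) ^ 2 / √(1 - (j * (a q / b q)) ^ 2)) := by
        rw [MeasureTheory.integral_const_mul, MeasureTheory.integral_add (integrable_const _)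
          (hi.1.const_mul _), MeasureTheory.integral_const_mul]
        simp [hk]
    _ ≤ b q * (k + (1 + k ^ 2) * (|a q / b q| * (π / 2))) := by
        gcongr; exact hi.2
    _ = b q * k + (1 + k ^ 2) * (|a q| * (π / 2)) := by
        rw [abs_div, abs_of_pos h0]; field_simp
    _ ≤ _ := by gcongr

/-- The slope vanishes at `k = 0`, hence is the integral of the curvature; exchange the two
integrals. -/
lemma integral_capSlope_nonneg (ha : Measurable a) (hb : Measurable b)
    (hab : ∀ᵐ q ∂μ, 0 < b q ∧ b q ≤ C ∧ |a q| ≤ C)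
    (hcurv : ∀ j, 0 < j → 0 ≤ ∫ q, b q * capCurvature (a q / b q) j ∂μ) {k : ℝ} (hk : 0 ≤ k) :
    0 ≤ ∫ q, b q * capSlope (a q / b q) k ∂μ := by
  have e : ∀ q, b q * capSlope (a q / b q) k =
      ∫ j in Ioc 0 k, b q * capCurvature (a q / b q) j := by
    intro q
    rw [MeasureTheory.integral_const_mul, (integral_capCurvature _ hk).2]
  simp only [e]
  rw [integral_integral_swap (integrable_capCurvature_prod ha hb hab hk)]
  exact setIntegral_nonneg measurableSet_Ioc fun j hj => hcurv j hj.1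

lemma abs_capSlope_le (r : ℝ) {k : ℝ} (hk : 0 ≤ k) : |capSlope r k| ≤ |r| * (π / 2) + k := by
  have h1 : √(1 - (k * r) ^ 2) ≤ 1 := sqrt_le_one.2 (by nlinarith [sq_nonneg (k * r)])
  have h0 := sqrt_nonneg (1 - (k * r) ^ 2)
  have h2 : |r * arcsin (k * r)| ≤ |r| * (π / 2) := by
    rw [abs_mul]; gcongr; exact abs_arcsin_le _
  have h3 : |k * √(1 - (k * r) ^ 2)| ≤ k := by
    rw [abs_mul, abs_of_nonneg hk, abs_of_nonneg h0]
    exact mul_le_of_le_one_right hk h1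
  exact (abs_sub _ _).trans (by linarith)

lemma one_le_sqrt_one_add_sq (j : ℝ) : 1 ≤ √(1 + j ^ 2) :=
  one_le_sqrt.2 (by nlinarith [sq_nonneg j])

lemma integrable_capSlope_prod (ha : Measurable a) (hb : Measurable b)
    (hab : ∀ᵐ q ∂μ, 0 < b q ∧ b q ≤ C ∧ |a q| ≤ C) {k J : ℝ} (hk : 0 ≤ k) :
    Integrable (Function.uncurry fun q j => b q * (capSlope (a q / b q) j / √(1 + j ^ 2) ^ 3))
      (μ.prod (volume.restrict (Ioc k J))) := by
  have hm : Measurable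
      (Function.uncurry fun q j => b q * (capSlope (a q / b q) j / √(1 + j ^ 2) ^ 3)) := by
    have := continuous_arcsin.measurable
    unfold capSlope Function.uncurry
    fun_prop
  refine Integrable.of_bound hm.aestronglyMeasurable (C * (π / 2) + C * J) ?_
  have h1 : ∀ᵐ p ∂μ.prod (volume.restrict (Ioc k J)), 0 < b p.1 ∧ b p.1 ≤ C ∧ |a p.1| ≤ C :=
    Measure.quasiMeasurePreserving_fst.ae hab
  have h2 : ∀ᵐ p ∂μ.prod (volume.restrict (Ioc k J)), p.2 ∈ Ioc k J :=
    Measure.quasiMeasurePreserving_snd.ae (ae_restrict_mem measurableSet_Ioc)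
  filter_upwards [h1, h2] with p ⟨hb0, hbC, haC⟩ hj
  have hj0 : 0 ≤ p.2 := hk.trans hj.1.le
  simp only [Function.uncurry]
  rw [norm_mul, norm_of_nonneg hb0.le, norm_div, norm_pow, norm_of_nonneg (sqrt_nonneg _)]
  calc b p.1 * (‖capSlope (a p.1 / b p.1) p.2‖ / √(1 + p.2 ^ 2) ^ 3)
      ≤ b p.1 * (|a p.1 / b p.1| * (π / 2) + p.2) := by
        gcongr
        exact (div_le_self (norm_nonneg _) (one_le_pow₀ (one_le_sqrt_one_add_sq _))).trans
          (abs_capSlope_le _ hj0)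
    _ = |a p.1| * (π / 2) + b p.1 * p.2 := by
        rw [abs_div, abs_of_pos hb0]; field_simp
    _ ≤ _ := by
        have := hj.2
        have : 0 ≤ C := hb0.le.trans hbC
        gcongr

lemma integrable_arcsinPrimitive (ha : Measurable a) (hb : Measurable b)
    (hab : ∀ᵐ q ∂μ, 0 < b q ∧ b q ≤ C ∧ |a q| ≤ C) {k : ℝ} (hk : 0 ≤ k) :
    Integrable (fun q => b q * (arcsinPrimitive (k * (a q / b q)) / √(1 + k ^ 2))) μ := by
  have hm : Measurable fun q => b q * (arcsinPrimitive (k * (a q / b q)) / √(1 + k ^ 2)) := by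
    have := continuous_arcsinPrimitive.measurable
    fun_prop
  refine Integrable.of_bound hm.aestronglyMeasurable (C + k * (C * (π / 2))) ?_
  filter_upwards [hab] with q ⟨hb0, hbC, haC⟩
  rw [norm_mul, norm_of_nonneg hb0.le, norm_div, norm_of_nonneg (arcsinPrimitive_nonneg _),
    norm_of_nonneg (sqrt_nonneg _)]
  calc b q * (arcsinPrimitive (k * (a q / b q)) / √(1 + k ^ 2))
      ≤ b q * (1 + |k * (a q / b q)| * (π / 2)) := by
        gcongr
        exact (div_le_self (arcsinPrimitive_nonneg _) (one_le_sqrt_one_add_sq _)).trans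
          (arcsinPrimitive_le _)
    _ = b q + k * (|a q| * (π / 2)) := by
        rw [abs_mul, abs_div, abs_of_pos hb0, abs_of_nonneg hk]; field_simp
    _ ≤ _ := by gcongr

lemma integral_arcsinPrimitive_mono (ha : Measurable a) (hb : Measurable b)
    (hab : ∀ᵐ q ∂μ, 0 < b q ∧ b q ≤ C ∧ |a q| ≤ C)
    (hcurv : ∀ j, 0 < j → 0 ≤ ∫ q, b q * capCurvature (a q / b q) j ∂μ)
    {k J : ℝ} (hk : 0 ≤ k) (hkJ : k ≤ J) :
    ∫ q, b q * (arcsinPrimitive (k * (a q / b q)) / √(1 + k ^ 2)) ∂μ ≤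
      ∫ q, b q * (arcsinPrimitive (J * (a q / b q)) / √(1 + J ^ 2)) ∂μ := by
  rw [← sub_nonneg, ← MeasureTheory.integral_sub
    (integrable_arcsinPrimitive ha hb hab (hk.trans hkJ)) (integrable_arcsinPrimitive ha hb hab hk)]
  have hne : ∀ j : ℝ, √(1 + j ^ 2) ≠ 0 := fun j =>
    (zero_lt_one.trans_le (one_le_sqrt_one_add_sq j)).ne'
  have e : ∀ q, b q * (arcsinPrimitive (J * (a q / b q)) / √(1 + J ^ 2)) -
      b q * (arcsinPrimitive (k * (a q / b q)) / √(1 + k ^ 2)) =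
      ∫ j in Ioc k J, b q * (capSlope (a q / b q) j / √(1 + j ^ 2) ^ 3) := by
    intro q
    rw [MeasureTheory.integral_const_mul, ← intervalIntegral.integral_of_le hkJ,
      MeasureTheory.integral_eq_of_hasDerivAt_off_countable
      (fun j => arcsinPrimitive (j * (a q / b q)) / √(1 + j ^ 2)) _
      (countable_mul_sq_eq_one (a q / b q))]
    · ring
    · have := continuous_arcsinPrimitive
      exact (Continuous.div (by fun_prop) (by fun_prop) hne).continuousOn
    · exact fun j hj => hasDerivAt_arcsinPrimitive_div hj.2
    · exact (Continuous.div (continuous_capSlope _) (by fun_prop)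
        fun j => pow_ne_zero _ (hne j)).intervalIntegrable _ _
  simp only [e]
  rw [integral_integral_swap (integrable_capSlope_prod ha hb hab hk)]
  refine setIntegral_nonneg measurableSet_Ioc fun j hj => ?_
  have e2 : ∀ q, b q * (capSlope (a q / b q) j / √(1 + j ^ 2) ^ 3) =
      b q * capSlope (a q / b q) j / √(1 + j ^ 2) ^ 3 := fun q => by ring
  simp only [e2]
  rw [MeasureTheory.integral_div]
  exact div_nonneg (integral_capSlope_nonneg ha hb hab hcurv (hk.trans hj.1.le)) (by positivity)

/-- By monotonicity `k` may be increased to `J → ∞`, where `arcsinPrimitive x ≤ 1 + |x| π / 2`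
leaves only the axial term. -/
lemma integral_arcsinPrimitive_le (ha : Measurable a) (hb : Measurable b)
    (hab : ∀ᵐ q ∂μ, 0 < b q ∧ b q ≤ C ∧ |a q| ≤ C)
    (hcurv : ∀ j, 0 < j → 0 ≤ ∫ q, b q * capCurvature (a q / b q) j ∂μ)
    {k : ℝ} (hk : 0 ≤ k) :
    ∫ q, b q * (arcsinPrimitive (k * (a q / b q)) / √(1 + k ^ 2)) ∂μ ≤
      π / 2 * ∫ q, |a q| ∂μ := by
  have hbi : Integrable b μ := by
    refine Integrable.of_bound hb.aestronglyMeasurable C ?_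
    filter_upwards [hab] with q hq
    rw [norm_of_nonneg hq.1.le]; exact hq.2.1
  have hai : Integrable (fun q => |a q|) μ := by
    refine Integrable.of_bound (by fun_prop) C ?_
    filter_upwards [hab] with q hq
    rw [norm_eq_abs, abs_abs]; exact hq.2.2
  have hbd : ∀ J, 0 < J → k ≤ J →
      ∫ q, b q * (arcsinPrimitive (k * (a q / b q)) / √(1 + k ^ 2)) ∂μ ≤
        (∫ q, b q ∂μ) / J + π / 2 * ∫ q, |a q| ∂μ := by
    intro J hJ hkJ
    refine (integral_arcsinPrimitive_mono ha hb hab hcurv hk hkJ).trans ?_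
    rw [← MeasureTheory.integral_const_mul, ← MeasureTheory.integral_div,
      ← MeasureTheory.integral_add (hbi.div_const _) (hai.const_mul _)]
    refine integral_mono_ae (integrable_arcsinPrimitive ha hb hab hJ.le)
      ((hbi.div_const _).add (hai.const_mul _)) ?_
    filter_upwards [hab] with q ⟨hb0, _, _⟩
    have hJs : J ≤ √(1 + J ^ 2) := le_sqrt_of_sq_le (by linarith)
    calc b q * (arcsinPrimitive (J * (a q / b q)) / √(1 + J ^ 2))
        ≤ b q * ((1 + |J * (a q / b q)| * (π / 2)) / J) := by
          gcongr
          exact arcsinPrimitive_le _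
      _ = _ := by
          rw [abs_mul, abs_div, abs_of_pos hb0, abs_of_pos hJ]; field_simp
  have hlim : Filter.Tendsto (fun J => (∫ q, b q ∂μ) / J + π / 2 * ∫ q, |a q| ∂μ) Filter.atTop
      (nhds (0 + π / 2 * ∫ q, |a q| ∂μ)) :=
    (Filter.Tendsto.div_atTop tendsto_const_nhds Filter.tendsto_id).add_const _
  rw [zero_add] at hlim
  refine ge_of_tendsto hlim ?_
  filter_upwards [Filter.eventually_gt_atTop 0, Filter.eventually_ge_atTop k] with J h1 h2
  exact hbd J h1 h2

/-- If the integrated curvature is nonnegative for every slope, the mean of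
`|c a + s b cos ψ|` over the unit circle of pairs `(c, s)` is largest at `(1, 0)`. -/
theorem integral_abs_zonal_le (ha : Measurable a) (hb : Measurable b)
    (hab : ∀ᵐ q ∂μ, 0 < b q ∧ b q ≤ C ∧ |a q| ≤ C)
    (hcurv : ∀ j, 0 < j → 0 ≤ ∫ q, b q * capCurvature (a q / b q) j ∂μ)
    {c s : ℝ} (hs : 0 ≤ s) (hcs : c ^ 2 + s ^ 2 = 1) :
    ∫ q, (∫ ψ in (-π)..π, |c * a q + s * b q * cos ψ|) ∂μ ≤ 2 * π * ∫ q, |a q| ∂μ := by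
  rcases hs.eq_or_lt with rfl | hs
  · have hc : |c| = 1 := by
      rw [← sq_eq_sq₀ (abs_nonneg _) zero_le_one, sq_abs]; linarith
    rw [← MeasureTheory.integral_const_mul]
    refine le_of_eq (integral_congr_ae (Filter.Eventually.of_forall fun q => ?_))
    simp only [zero_mul, add_zero, intervalIntegral.integral_const, abs_mul, hc, smul_eq_mul]
    ring
  · have hk : 0 ≤ |c| / s := by positivity
    have h := integral_arcsinPrimitive_le ha hb hab hcurv hk
    have hsq : √(1 + (|c| / s) ^ 2) = 1 / s := by
      rw [show 1 + (|c| / s) ^ 2 = (1 / s) ^ 2 by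
        rw [div_pow, sq_abs]; field_simp; linarith]
      exact sqrt_sq (by positivity)
    have e : ∫ q, (∫ ψ in (-π)..π, |c * a q + s * b q * cos ψ|) ∂μ =
        4 * ∫ q, b q * (arcsinPrimitive (|c| / s * (a q / b q)) / √(1 + (|c| / s) ^ 2)) ∂μ := by
      rw [← MeasureTheory.integral_const_mul]
      refine integral_congr_ae ?_
      filter_upwards [hab] with q ⟨hb0, _, _⟩
      rw [integral_abs_add_mul_cos (mul_pos hs hb0), hsq]
      have e1 : arcsinPrimitive (c * a q / (s * b q)) =
          arcsinPrimitive (|c| / s * (a q / b q)) := by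
        rcases abs_choice c with h | h <;> rw [h]
        · congr 1; field_simp
        · rw [← arcsinPrimitive_neg]; congr 1; field_simp
      rw [e1]; field_simp
    rw [e]
    linarith

end ZonalAverages

/-! ### The axial and transversal parts for the ball, and their curvature integral. -/

/-- The part of the derivative of the Poisson kernel on a parallel circle of the sphere that does
not depend on the angle, in terms of `q = (1 - ρ ^ 2) / |x - ζ|`. -/
noncomputable def axialPart (ρ q : ℝ) : ℝ := 3 + ρ ^ 2 - 3 * q ^ 2

/-- The amplitude of the part of the derivative of the Poisson kernel on a parallel circle of the
sphere that varies with the angle. -/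
noncomputable def transversalPart (ρ q : ℝ) : ℝ :=
  3 * √((q ^ 2 - (1 - ρ) ^ 2) * ((1 + ρ) ^ 2 - q ^ 2))

lemma continuous_axialPart (ρ : ℝ) : Continuous (axialPart ρ) := by
  unfold axialPart; fun_prop

lemma continuous_transversalPart (ρ : ℝ) : Continuous (transversalPart ρ) := by
  unfold transversalPart; fun_prop

lemma shell_product_pos {ρ q : ℝ} (hρ1 : ρ < 1) (hq : q ∈ Ioo (1 - ρ) (1 + ρ)) :
    0 < (q ^ 2 - (1 - ρ) ^ 2) * ((1 + ρ) ^ 2 - q ^ 2) := by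
  have h1 : 0 < 1 - ρ := by linarith
  have h2 := hq.1
  have h3 := hq.2
  apply mul_pos <;> nlinarith

lemma transversalPart_pos {ρ q : ℝ} (hρ1 : ρ < 1) (hq : q ∈ Ioo (1 - ρ) (1 + ρ)) :
    0 < transversalPart ρ q :=
  mul_pos three_pos (sqrt_pos.2 (shell_product_pos hρ1 hq))

lemma mem_Ioo_of_shell_product_pos {ρ q : ℝ} (hρ : 0 < ρ) (hρ1 : ρ < 1) (hq : 0 < q)
    (h : 0 < (q ^ 2 - (1 - ρ) ^ 2) * ((1 + ρ) ^ 2 - q ^ 2)) : q ∈ Ioo (1 - ρ) (1 + ρ) := by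
  rcases mul_pos_iff.1 h with ⟨h1, h2⟩ | ⟨h1, h2⟩
  · exact ⟨lt_of_pow_lt_pow_left₀ 2 hq.le (by linarith),
      lt_of_pow_lt_pow_left₀ 2 (by linarith) (by linarith)⟩
  · nlinarith

/-- Writes the weighted curvature through the radicand `W`, since `(1 + 2 j²) a² - b² = (1 + j²) a²
- (b² - j² a²)`. The degenerate case `W ≤ 0` is included, both sides being `0`. -/
lemma mul_capCurvature_eq {a b j y W : ℝ} (hb : 0 < b) (ha : a ^ 2 = 9 * y ^ 2)
    (hW : b ^ 2 - j ^ 2 * a ^ 2 = 9 * W) :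
    b * capCurvature (a / b) j = 3 * ((1 + j ^ 2) * y ^ 2 - W) / √W := by
  have e1 : 1 - (j * (a / b)) ^ 2 = (3 / b) ^ 2 * W := by
    field_simp; linarith
  have e2 : √(1 - (j * (a / b)) ^ 2) = 3 / b * √W := by
    rw [e1, sqrt_mul (by positivity), sqrt_sq (by positivity)]
  have e3 : (1 + 2 * j ^ 2) * (a / b) ^ 2 - 1 = 9 * ((1 + j ^ 2) * y ^ 2 - W) / b ^ 2 := by
    field_simp
    linear_combination (1 + j ^ 2) * ha - hW
  rw [capCurvature, e2, e3]
  rcases eq_or_ne (√W) 0 with h | h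
  · simp [h]
  · field_simp; ring

lemma integral_capCurvature_shell_nonneg {ρ : ℝ} (hρ : 0 < ρ) (hρ1 : ρ < 1) {j : ℝ} (hj : 0 < j) :
    0 ≤ ∫ q in Ioo (1 - ρ) (1 + ρ),
      transversalPart ρ q * capCurvature (axialPart ρ q / transversalPart ρ q) j := by
  set κ := 1 + j ^ 2 with hκdef
  have hκ : 1 < κ := by rw [hκdef]; nlinarith
  -- In the variable `y = q² - 1 - ρ² / 3`, which is `-1/3` times the axial part, `b² - j² a²`
  -- equals `9 W(y)` with `W` quadratic. Completing the square gives the centre `e` and the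
  -- half-width `d` of the interval where `W > 0`.
  set δ := 2 * ρ ^ 2 / 3 with hδ
  have hδ0 : 0 < δ := by positivity
  set e := δ / κ with he
  have he0 : 0 < e := by positivity
  have heδ : e ≤ δ := div_le_self hδ0.le hκ.le
  have hκe : κ * e = δ := by rw [he]; field_simp
  have hpos : 0 < 4 * ρ ^ 2 - δ ^ 2 := by
    have : δ < 2 * ρ := by rw [hδ]; nlinarith
    nlinarith
  set d := √(e ^ 2 + (4 * ρ ^ 2 - δ ^ 2) / κ) with hd
  have hd0 : 0 < d := sqrt_pos.2 (by positivity)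
  have hd2 : κ * d ^ 2 = κ * e ^ 2 + (4 * ρ ^ 2 - δ ^ 2) := by
    rw [hd, sq_sqrt (by positivity)]; field_simp
  set L := 1 + ρ ^ 2 / 3 + e with hLdef
  let W : ℝ → ℝ := fun y => 4 * ρ ^ 2 - (y - δ) ^ 2 - j ^ 2 * y ^ 2
  have hW : ∀ y, W y = κ * (d ^ 2 - (y - e) ^ 2) := by
    intro y
    have : κ * (d ^ 2 - (y - e) ^ 2) = κ * d ^ 2 - κ * y ^ 2 + 2 * (κ * e) * y - κ * e ^ 2 := by
      ring
    rw [this, hd2, hκe]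
    simp only [W, hκdef]; ring
  clear_value d
  -- Since `e - d` is a root of `W`, it satisfies `|e - d - δ| ≤ 2 ρ`, whence `L - d ≥ (1 - ρ)² >
  -- 0`.
  have hLd : d < L := by
    have h1 : W (e - d) = 0 := by rw [hW]; ring
    have h2 : (e - d - δ) ^ 2 ≤ (2 * ρ) ^ 2 := by
      simp only [W] at h1
      nlinarith [mul_nonneg (sq_nonneg j) (sq_nonneg (e - d))]
    have h3 := (abs_le_of_sq_le_sq' h2 (by positivity)).1
    have h4 : L - d = 1 + ρ ^ 2 + (e - d - δ) := by rw [hLdef, hδ]; ring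
    nlinarith [mul_pos (sub_pos.2 hρ1) (sub_pos.2 hρ1)]
  have heL : e ≤ 2 / 3 * L := by
    rw [hLdef]; nlinarith
  have hell := elliptic_integral_nonneg hd0 hLd heL
  let f : ℝ → ℝ := fun φ => √(L + d * cos φ)
  have hf0 : ∀ φ, 0 < f φ := fun φ => sqrt_pos.2 (add_mul_cos_pos hd0 hLd φ)
  have hf2 : ∀ φ, f φ ^ 2 = L + d * cos φ := fun φ => sq_sqrt (add_mul_cos_pos hd0 hLd φ).le
  have hfder : ∀ φ, HasDerivAt f (d * -sin φ / (2 * f φ)) φ := fun φ =>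
    (((hasDerivAt_cos φ).const_mul d).const_add L).sqrt (add_mul_cos_pos hd0 hLd φ).ne'
  let T : ℝ → ℝ := fun q => 3 * (κ * (q ^ 2 - 1 - ρ ^ 2 / 3) ^ 2 - W (q ^ 2 - 1 - ρ ^ 2 / 3)) /
    √(W (q ^ 2 - 1 - ρ ^ 2 / 3))
  have hprod : ∀ q, 4 * ρ ^ 2 - (q ^ 2 - 1 - ρ ^ 2 / 3 - δ) ^ 2 =
      (q ^ 2 - (1 - ρ) ^ 2) * ((1 + ρ) ^ 2 - q ^ 2) := by
    intro q; rw [hδ]; ring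
  have hint : ∫ q in Ioo (1 - ρ) (1 + ρ),
      transversalPart ρ q * capCurvature (axialPart ρ q / transversalPart ρ q) j =
      ∫ q in Ioo (1 - ρ) (1 + ρ), T q := by
    refine setIntegral_congr_fun measurableSet_Ioo fun q hq => ?_
    have hP := shell_product_pos hρ1 hq
    refine mul_capCurvature_eq (transversalPart_pos hρ1 hq) ?_ ?_
    · simp only [axialPart]; ring
    · simp only [transversalPart, axialPart, W, mul_pow, sq_sqrt hP.le, hprod]; ring
  have hfsub : f '' Ioo 0 π ⊆ Ioo (1 - ρ) (1 + ρ) := by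
    rintro _ ⟨φ, hφ, rfl⟩
    have h1 : 0 < W (f φ ^ 2 - 1 - ρ ^ 2 / 3) := by
      rw [hW, hf2, show L + d * cos φ - 1 - ρ ^ 2 / 3 - e = d * cos φ by rw [hLdef]; ring,
        mul_pow, ← mul_one_sub, ← sin_sq]
      have := sin_pos_of_mem_Ioo hφ
      positivity
    have h2 : 0 < (f φ ^ 2 - (1 - ρ) ^ 2) * ((1 + ρ) ^ 2 - f φ ^ 2) := by
      rw [← hprod]
      simp only [W] at h1
      nlinarith [mul_nonneg (sq_nonneg j) (sq_nonneg (f φ ^ 2 - 1 - ρ ^ 2 / 3))]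
    exact mem_Ioo_of_shell_product_pos hρ hρ1 (hf0 φ) h2
  -- Where `W ≤ 0` the integrand is `0` by division by zero, so only the image of the substitution
  -- `q = √(L + d cos φ)` contributes.
  have hfzero : ∀ q ∈ Ioo (1 - ρ) (1 + ρ) \ f '' Ioo 0 π, T q = 0 := by
    rintro q ⟨hq, hqf⟩
    have hq0 : 0 < q := by linarith [hq.1]
    suffices hle : W (q ^ 2 - 1 - ρ ^ 2 / 3) ≤ 0 by
      simp only [T, sqrt_eq_zero_of_nonpos hle, div_zero]
    by_contra! hgt
    apply hqf
    set y := q ^ 2 - 1 - ρ ^ 2 / 3 with hy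
    rw [hW] at hgt
    have h1 : (y - e) ^ 2 < d ^ 2 := by
      have := pos_of_mul_pos_right hgt (by positivity)
      linarith
    have h2 := abs_lt_of_sq_lt_sq' h1 hd0.le
    have h3 : -1 < (y - e) / d := by rw [lt_div_iff₀ hd0]; linarith
    have h4 : (y - e) / d < 1 := by rw [div_lt_one hd0]; exact h2.2
    refine ⟨arccos ((y - e) / d), ⟨arccos_pos.2 h4, ?_⟩, ?_⟩
    · refine lt_of_le_of_ne (arccos_le_pi _) fun h => ?_
      rw [arccos_eq_pi] at h; linarith
    · simp only [f]
      rw [cos_arccos h3.le h4.le, show L + d * ((y - e) / d) = q ^ 2 by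
        rw [hLdef, hy]; field_simp; ring]
      exact sqrt_sq hq0.le
  have hinj : InjOn f (Ioo 0 π) := by
    intro φ hφ φ' hφ' h
    have h1 : L + d * cos φ = L + d * cos φ' := by rw [← hf2, ← hf2, h]
    have h2 : cos φ = cos φ' := by
      have := add_left_cancel h1
      exact mul_left_cancel₀ hd0.ne' this
    exact injOn_cos (Ioo_subset_Icc_self hφ) (Ioo_subset_Icc_self hφ') h2
  have himg : ∫ q in f '' Ioo 0 π, T q = ∫ q in Ioo (1 - ρ) (1 + ρ), T q :=
    (setIntegral_eq_of_subset_of_forall_sdiff_eq_zero measurableSet_Ioo hfsub hfzero).symm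
  rw [hint, ← himg, integral_image_eq_integral_abs_deriv_smul measurableSet_Ioo
    (fun φ _ => (hfder φ).hasDerivWithinAt) hinj]
  have hcongr : ∫ φ in Ioo 0 π, |d * -sin φ / (2 * f φ)| • T (f φ) =
      ∫ φ in Ioo 0 π, 3 * √κ / 2 *
        (((e + d * cos φ) ^ 2 - d ^ 2 * sin φ ^ 2) / √(L + d * cos φ)) := by
    refine setIntegral_congr_fun measurableSet_Ioo fun φ hφ => ?_
    have hsin := sin_pos_of_mem_Ioo hφ
    have hy : f φ ^ 2 - 1 - ρ ^ 2 / 3 = e + d * cos φ := by rw [hf2, hLdef]; ring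
    have hWy : W (e + d * cos φ) = κ * (d * sin φ) ^ 2 := by
      rw [hW, mul_pow, sin_sq]; ring
    have hsq : √(W (e + d * cos φ)) = √κ * (d * sin φ) := by
      rw [hWy, sqrt_mul (by positivity), sqrt_sq (by positivity)]
    have habs : |d * -sin φ / (2 * f φ)| = d * sin φ / (2 * f φ) := by
      rw [show d * -sin φ / (2 * f φ) = -(d * sin φ / (2 * f φ)) by ring, abs_neg]
      have := hf0 φ
      exact abs_of_nonneg (by positivity)
    have hκs : √κ ^ 2 = κ := sq_sqrt (by positivity)
    have hκ0 : 0 < √κ := sqrt_pos.2 (by positivity)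
    change |d * -sin φ / (2 * f φ)| • T (f φ) = 3 * √κ / 2 *
        (((e + d * cos φ) ^ 2 - d ^ 2 * sin φ ^ 2) / f φ)
    simp only [T, smul_eq_mul]
    rw [habs, hy, hsq, hWy]
    have := hf0 φ
    generalize f φ = F at *
    generalize √κ = K at *
    rw [← hκs]
    field_simp
  rw [hcongr, MeasureTheory.integral_const_mul, ← integral_Ioc_eq_integral_Ioo,
    ← intervalIntegral.integral_of_le pi_pos.le]
  positivity

lemma integral_abs_shell_le {ρ : ℝ} (hρ : 0 < ρ) (hρ1 : ρ < 1) {c s : ℝ} (hs : 0 ≤ s)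
    (hcs : c ^ 2 + s ^ 2 = 1) :
    ∫ q in (1 - ρ)..(1 + ρ), ∫ ψ in (-π)..π,
      |c * axialPart ρ q + s * transversalPart ρ q * cos ψ| ≤
    2 * π * ∫ q in (1 - ρ)..(1 + ρ), |axialPart ρ q| := by
  have hle : 1 - ρ ≤ 1 + ρ := by linarith
  rw [intervalIntegral.integral_of_le hle, intervalIntegral.integral_of_le hle,
    integral_Ioc_eq_integral_Ioo, integral_Ioc_eq_integral_Ioo]
  obtain ⟨C₁, hC₁⟩ := isCompact_Icc.exists_bound_of_continuousOn
    (continuous_axialPart ρ).continuousOn (s := Icc (1 - ρ) (1 + ρ))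
  obtain ⟨C₂, hC₂⟩ := isCompact_Icc.exists_bound_of_continuousOn
    (continuous_transversalPart ρ).continuousOn (s := Icc (1 - ρ) (1 + ρ))
  refine integral_abs_zonal_le (C := max C₁ C₂) (continuous_axialPart ρ).measurable
    (continuous_transversalPart ρ).measurable ?_
    (fun j hj => integral_capCurvature_shell_nonneg hρ hρ1 hj) hs hcs
  filter_upwards [ae_restrict_mem measurableSet_Ioo] with q hq
  have hq' := Ioo_subset_Icc_self hq
  exact ⟨transversalPart_pos hρ1 hq,
    ((le_abs_self _).trans (hC₂ q hq')).trans (le_max_right _ _),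
    (hC₁ q hq').trans (le_max_left _ _)⟩

/-- The axial part changes sign at `q₀ = √(1 + ρ² / 3)`; the exponent `3/2` in the constant is
`q₀³`. -/
lemma integral_abs_axialPart {ρ : ℝ} (hρ : 0 < ρ) (hρ1 : ρ < 1) :
    ∫ q in (1 - ρ)..(1 + ρ), |axialPart ρ q| =
      4 * ((1 + ρ ^ 2 / 3) ^ (3 / 2 : ℝ) - (1 - ρ ^ 2)) := by
  set q₀ := √(1 + ρ ^ 2 / 3) with hq₀
  have hq0 : 0 < q₀ := sqrt_pos.2 (by positivity)
  have hq2 : q₀ ^ 2 = 1 + ρ ^ 2 / 3 := sq_sqrt (by positivity)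
  have hpow : (1 + ρ ^ 2 / 3) ^ (3 / 2 : ℝ) = q₀ ^ 3 := by
    rw [hq₀, sqrt_eq_rpow, ← rpow_natCast _ 3, ← rpow_mul (by positivity)]; norm_num
  have h1 : 1 - ρ ≤ q₀ := by nlinarith
  have h2 : q₀ ≤ 1 + ρ := by nlinarith
  have hF : ∀ u v, ∫ q in u..v, axialPart ρ q =
      (3 + ρ ^ 2) * (v - u) - (v ^ 3 - u ^ 3) := by
    intro u v
    simp only [axialPart]
    rw [intervalIntegral.integral_sub (Continuous.intervalIntegrable (by fun_prop) _ _)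
      (Continuous.intervalIntegrable (by fun_prop) _ _), intervalIntegral.integral_const,
      intervalIntegral.integral_const_mul, integral_pow]
    simp; ring
  have hc : Continuous fun q => |axialPart ρ q| := (continuous_axialPart ρ).abs
  rw [← integral_add_adjacent_intervals (hc.intervalIntegrable _ q₀)
    (hc.intervalIntegrable q₀ _)]
  have e1 : ∫ q in (1 - ρ)..q₀, |axialPart ρ q| = ∫ q in (1 - ρ)..q₀, axialPart ρ q := by
    refine intervalIntegral.integral_congr fun q hq => ?_
    rw [uIcc_of_le h1] at hq
    refine abs_of_nonneg ?_
    have : q ^ 2 ≤ q₀ ^ 2 := by have := hq.1; have := hq.2; gcongr; linarith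
    unfold axialPart; linarith
  have e2 : ∫ q in q₀..(1 + ρ), |axialPart ρ q| = ∫ q in q₀..(1 + ρ), -axialPart ρ q := by
    refine intervalIntegral.integral_congr fun q hq => ?_
    rw [uIcc_of_le h2] at hq
    refine abs_of_nonpos ?_
    have : q₀ ^ 2 ≤ q ^ 2 := by have := hq.1; gcongr
    unfold axialPart; linarith
  rw [e1, e2, intervalIntegral.integral_neg, hF, hF, hpow]
  have h3 : q₀ ^ 3 = (1 + ρ ^ 2 / 3) * q₀ := by rw [← hq2]; ring
  rw [h3]; ring

/-! ### The Poisson kernel, its two derivatives and its harmonicity. -/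

section Kernel

variable {E : Type*} [NormedAddCommGroup E] [InnerProductSpace ℝ E]

/-- The real inner product as a bilinear map. -/
noncomputable def innerL : E →L[ℝ] E →L[ℝ] ℝ := innerSL ℝ

@[simp] lemma innerL_apply (v w : E) : innerL v w = inner ℝ v w := rfl

/-- The Poisson kernel of the unit ball of a three-dimensional space with pole `ζ`. -/
noncomputable def ballPoisson {F : Type*} [NormedAddCommGroup F] (ζ y : F) : ℝ :=
  (1 - ‖y‖ ^ 2) * (‖y - ζ‖ ^ 2) ^ (-(3 / 2) : ℝ)

/-- The derivative of `ballPoisson ζ`. -/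
noncomputable def ballPoissonDeriv (ζ y : E) : E →L[ℝ] ℝ :=
  (-2 * (‖y - ζ‖ ^ 2) ^ (-(3 / 2) : ℝ)) • innerL y +
    (-3 * (1 - ‖y‖ ^ 2) * (‖y - ζ‖ ^ 2) ^ (-(5 / 2) : ℝ)) • innerL (y - ζ)

/-- The second derivative of `ballPoisson ζ`. -/
noncomputable def ballPoissonDeriv2 (ζ y : E) : E →L[ℝ] E →L[ℝ] ℝ :=
  ((-2 * (‖y - ζ‖ ^ 2) ^ (-(3 / 2) : ℝ)) • innerL +
    ((6 * (‖y - ζ‖ ^ 2) ^ (-(5 / 2) : ℝ)) • innerL (y - ζ)).smulRight (innerL y)) +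
  ((-3 * (1 - ‖y‖ ^ 2) * (‖y - ζ‖ ^ 2) ^ (-(5 / 2) : ℝ)) •
      innerL +
    ((6 * (‖y - ζ‖ ^ 2) ^ (-(5 / 2) : ℝ)) • innerL y +
      (15 * (1 - ‖y‖ ^ 2) * (‖y - ζ‖ ^ 2) ^ (-(7 / 2) : ℝ)) • innerL (y - ζ)).smulRight
        (innerL (y - ζ)))

lemma sub_ne_zero_of_sphere {F : Type*} [NormedAddCommGroup F] {ζ y : F} (hζ : ‖ζ‖ = 1) (hy : ‖y‖ < 1) : y - ζ ≠ 0 := by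
  intro h
  rw [sub_eq_zero] at h
  rw [h] at hy
  linarith

lemma norm_sub_sq_pos {F : Type*} [NormedAddCommGroup F] {ζ y : F} (hζ : ‖ζ‖ = 1) (hy : ‖y‖ < 1) : 0 < ‖y - ζ‖ ^ 2 := by
  have := norm_pos_iff.2 (sub_ne_zero_of_sphere hζ hy)
  positivity

lemma hasFDerivAt_norm_sub_sq (ζ y : E) :
    HasFDerivAt (fun y : E => ‖y - ζ‖ ^ 2) ((2 : ℝ) • innerL (y - ζ)) y := by
  have h := ((hasFDerivAt_id y).sub_const ζ).norm_sq
  refine h.congr_fderiv ?_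
  ext v; simp

lemma hasFDerivAt_norm_sq (y : E) :
    HasFDerivAt (fun y : E => 1 - ‖y‖ ^ 2) ((-2 : ℝ) • innerL y) y := by
  have h := ((hasFDerivAt_id y).norm_sq).const_sub 1
  refine h.congr_fderiv ?_
  ext v; simp

lemma hasFDerivAt_norm_sub_sq_rpow {ζ y : E} (h : y - ζ ≠ 0) (p : ℝ) :
    HasFDerivAt (fun y : E => (‖y - ζ‖ ^ 2) ^ p)
      ((2 * p * (‖y - ζ‖ ^ 2) ^ (p - 1)) • innerL (y - ζ)) y := by
  have h0 : ‖y - ζ‖ ^ 2 ≠ 0 := pow_ne_zero _ (norm_ne_zero_iff.2 h)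
  refine ((hasFDerivAt_norm_sub_sq ζ y).rpow_const (Or.inl h0)).congr_fderiv ?_
  rw [smul_smul]; congr 1; ring

lemma hasFDerivAt_ballPoisson {ζ y : E} (h : y - ζ ≠ 0) :
    HasFDerivAt (ballPoisson ζ) (ballPoissonDeriv ζ y) y := by
  refine ((hasFDerivAt_norm_sq y).mul (hasFDerivAt_norm_sub_sq_rpow h (-(3 / 2)))).congr_fderiv ?_
  rw [show (-(3 / 2) - 1 : ℝ) = -(5 / 2) by norm_num, ballPoissonDeriv]
  ext v
  simp
  ring

lemma hasFDerivAt_ballPoissonDeriv {ζ y : E} (h : y - ζ ≠ 0) :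
    HasFDerivAt (ballPoissonDeriv ζ) (ballPoissonDeriv2 ζ y) y := by
  have hi : HasFDerivAt (fun y : E => innerL y)
      innerL y :=
    innerL.hasFDerivAt
  have hi' : HasFDerivAt (fun y : E => innerL (y - ζ))
      innerL y :=
    innerL.hasFDerivAt.comp y
      ((hasFDerivAt_id y).sub_const ζ)
  have h3 := (hasFDerivAt_norm_sub_sq_rpow h (-(3 / 2))).const_mul (-2)
  have h5 := ((hasFDerivAt_norm_sq y).const_mul (-3)).mul
    (hasFDerivAt_norm_sub_sq_rpow h (-(5 / 2)))
  refine ((h3.smul hi).add (h5.smul hi')).congr_fderiv ?_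
  rw [show (-(3 / 2) - 1 : ℝ) = -(5 / 2) by norm_num,
    show (-(5 / 2) - 1 : ℝ) = -(7 / 2) by norm_num, ballPoissonDeriv2]
  ext v w
  simp
  ring

lemma rpow_neg_step {N : ℝ} (hN : 0 < N) (p : ℝ) : N ^ p = N * N ^ (p - 1) := by
  rw [rpow_sub_one hN.ne']; field_simp

/-- The trace is computed with all powers reduced to the exponent `-7/2`. What remains is a
polynomial identity relying on `‖ζ‖ = 1` and on the dimension being three. -/
lemma sum_ballPoissonDeriv2 (b : OrthonormalBasis (Fin 3) ℝ E) {ζ y : E}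
    (hζ : ‖ζ‖ = 1) (hy : ‖y‖ < 1) : ∑ i, ballPoissonDeriv2 ζ y (b i) (b i) = 0 := by
  have hN := norm_sub_sq_pos hζ hy
  have hval : ∀ v, ‖v‖ = 1 → ballPoissonDeriv2 ζ y v v =
      (-2 * (‖y - ζ‖ ^ 2) ^ (-(3 / 2) : ℝ) -
        3 * (1 - ‖y‖ ^ 2) * (‖y - ζ‖ ^ 2) ^ (-(5 / 2) : ℝ)) +
      12 * (‖y - ζ‖ ^ 2) ^ (-(5 / 2) : ℝ) * (inner ℝ (y - ζ) v * inner ℝ v y) +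
      15 * (1 - ‖y‖ ^ 2) * (‖y - ζ‖ ^ 2) ^ (-(7 / 2) : ℝ) *
        (inner ℝ (y - ζ) v * inner ℝ v (y - ζ)) := by
    intro v hv
    have hvv : inner ℝ v v = 1 := by rw [real_inner_self_eq_norm_sq, hv]; norm_num
    rw [real_inner_comm y v, real_inner_comm (y - ζ) v]
    simp only [ballPoissonDeriv2, _root_.add_apply, _root_.smul_apply,
      ContinuousLinearMap.smulRight_apply, innerL_apply, smul_eq_mul, hvv]
    ring
  simp only [hval _ (b.norm_eq_one _)]
  rw [Finset.sum_add_distrib, Finset.sum_add_distrib, ← Finset.mul_sum, ← Finset.mul_sum,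
    b.sum_inner_mul_inner, b.sum_inner_mul_inner, real_inner_self_eq_norm_sq]
  rw [rpow_neg_step hN (-(3 / 2)), show (-(3 / 2) - 1 : ℝ) = -(5 / 2) by norm_num,
    rpow_neg_step hN (-(5 / 2)), show (-(5 / 2) - 1 : ℝ) = -(7 / 2) by norm_num]
  have h1 : ‖y - ζ‖ ^ 2 = ‖y‖ ^ 2 - 2 * inner ℝ y ζ + 1 := by
    rw [norm_sub_sq_real, hζ]; norm_num
  have h2 : inner ℝ (y - ζ) y = ‖y‖ ^ 2 - inner ℝ y ζ := by
    rw [inner_sub_left, real_inner_self_eq_norm_sq, real_inner_comm]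
  rw [h2]
  generalize (‖y - ζ‖ ^ 2) ^ (-(7 / 2) : ℝ) = R
  simp only [Finset.sum_const, Finset.card_univ, Fintype.card_fin, nsmul_eq_mul]
  rw [h1]
  push_cast
  ring

/-- The pairs of a pole on the unit sphere and a point of the open unit ball. -/
def kernelDomain (E : Type*) [NormedAddCommGroup E] : Set (E × E) := Metric.sphere 0 1 ×ˢ Metric.ball 0 1

lemma continuousOn_norm_sub_sq_rpow {F : Type*} [NormedAddCommGroup F] (p : ℝ) :
    ContinuousOn (fun q : F × F => (‖q.2 - q.1‖ ^ 2) ^ p) (kernelDomain F) := by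
  refine ContinuousOn.rpow_const (by fun_prop) fun q hq => Or.inl ?_
  exact (norm_sub_sq_pos (by simpa using hq.1) (by simpa using hq.2)).ne'

lemma continuousOn_ballPoisson {F : Type*} [NormedAddCommGroup F] :
    ContinuousOn (fun q : F × F => ballPoisson q.1 q.2) (kernelDomain F) :=
  ContinuousOn.mul (by fun_prop) (continuousOn_norm_sub_sq_rpow _)

lemma continuousOn_ballPoissonDeriv :
    ContinuousOn (fun q : E × E => ballPoissonDeriv q.1 q.2) (kernelDomain E) := by
  have h3 := continuousOn_norm_sub_sq_rpow (F := E) (-(3 / 2))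
  have h5 := continuousOn_norm_sub_sq_rpow (F := E) (-(5 / 2))
  unfold ballPoissonDeriv
  fun_prop

lemma continuousOn_smul_add_smulRight {X G : Type*} [TopologicalSpace X] [NormedAddCommGroup G]
    [NormedSpace ℝ G] {t : Set X} {c : X → ℝ} {L : E →L[ℝ] G} {f : X → E →L[ℝ] ℝ} {g : X → G}
    (hc : ContinuousOn c t) (hf : ContinuousOn f t) (hg : ContinuousOn g t) :
    ContinuousOn (fun q => c q • L + (f q).smulRight (g q)) t :=
  (hc.smul continuousOn_const).add
    (((ContinuousLinearMap.smulRightL ℝ E G).continuous.comp_continuousOn hf).clm_apply hg)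

lemma continuousOn_ballPoissonDeriv2 :
    ContinuousOn (fun q : E × E => ballPoissonDeriv2 q.1 q.2) (kernelDomain E) := by
  have h3 := continuousOn_norm_sub_sq_rpow (F := E) (-(3 / 2))
  have h5 := continuousOn_norm_sub_sq_rpow (F := E) (-(5 / 2))
  have h7 := continuousOn_norm_sub_sq_rpow (F := E) (-(7 / 2))
  have hadd : ∀ {G : Type _} [NormedAddCommGroup G] {f g : E × E → G} {t : Set (E × E)},
      ContinuousOn f t → ContinuousOn g t → ContinuousOn (fun q => f q + g q) t :=
    fun hf hg => hf.add hg
  exact hadd (continuousOn_smul_add_smulRight (by fun_prop) (by fun_prop) (by fun_prop))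
    (continuousOn_smul_add_smulRight (by fun_prop) (by fun_prop) (by fun_prop))

end Kernel

/-! ### Differentiation under the integral sign for Poisson integrals. -/

section KernelIntegrals

variable {E G : Type*} [NormedAddCommGroup E] [InnerProductSpace ℝ E] [FiniteDimensional ℝ E]
  [NormedAddCommGroup G] [NormedSpace ℝ G] {ν : Measure (ℝ × ℝ)} {z : ℝ × ℝ → E} {g : ℝ × ℝ → ℝ}

/-- Compactness of sphere times smaller closed ball supplies the dominating constants for all the
integrals of kernels below. -/
lemma exists_kernel_bound {E H : Type*} [NormedAddCommGroup E] [InnerProductSpace ℝ E]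
    [FiniteDimensional ℝ E] [NormedAddCommGroup H] {F : E → E → H}
    (hF : ContinuousOn (fun q : E × E => F q.1 q.2) (kernelDomain E)) {r : ℝ} (hr : r < 1) :
    ∃ C, ∀ ζ y, ‖ζ‖ = 1 → ‖y‖ ≤ r → ‖F ζ y‖ ≤ C := by
  have : ProperSpace E := FiniteDimensional.proper ℝ E
  obtain ⟨C, hC⟩ := ((isCompact_sphere (0 : E) 1).prod
    (isCompact_closedBall (0 : E) r)).exists_bound_of_continuousOn
    (hF.mono (prod_mono_right (Metric.closedBall_subset_ball hr)))
  exact ⟨C, fun ζ y hζ hy => hC (ζ, y) ⟨by simpa using hζ, by simpa using hy⟩⟩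

lemma continuous_kernel_comp {E H : Type*} [NormedAddCommGroup E] [NormedAddCommGroup H]
    {z : ℝ × ℝ → E} {F : E → E → H}
    (hF : ContinuousOn (fun q : E × E => F q.1 q.2) (kernelDomain E)) (hz : Continuous z)
    (hz1 : ∀ p, ‖z p‖ = 1) {y : E} (hy : ‖y‖ < 1) : Continuous fun p => F (z p) y :=
  hF.comp_continuous (f := fun p => (z p, y)) (by fun_prop)
    fun p => ⟨by simpa using hz1 p, by simpa using hy⟩

lemma integrable_kernel {F : E → E → G}
    (hF : ContinuousOn (fun q : E × E => F q.1 q.2) (kernelDomain E)) (hz : Continuous z)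
    (hz1 : ∀ p, ‖z p‖ = 1) (hg : Integrable g ν) {y : E} (hy : ‖y‖ < 1) :
    Integrable (fun p => g p • F (z p) y) ν := by
  obtain ⟨C, hC⟩ := exists_kernel_bound hF hy
  refine Integrable.mono' (hg.norm.mul_const C) (hg.aestronglyMeasurable.smul
    (continuous_kernel_comp hF hz hz1 hy).aestronglyMeasurable) (ae_of_all _ fun p => ?_)
  rw [norm_smul]
  exact mul_le_mul_of_nonneg_left (hC _ _ (hz1 p) le_rfl) (norm_nonneg _)

lemma exists_closedBall_mem_nhds {E : Type*} [NormedAddCommGroup E] {y : E} (hy : ‖y‖ < 1) :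
    ∃ r < 1, Metric.closedBall (0 : E) r ∈ nhds y := by
  obtain ⟨r, h1, h2⟩ := exists_between hy
  exact ⟨r, h2, Filter.mem_of_superset (Metric.isOpen_ball.mem_nhds (by simpa using h1))
    Metric.ball_subset_closedBall⟩

lemma hasFDerivAt_integral_kernel {F : E → E → G} {F' : E → E → E →L[ℝ] G}
    (hF : ContinuousOn (fun q : E × E => F q.1 q.2) (kernelDomain E))
    (hF' : ContinuousOn (fun q : E × E => F' q.1 q.2) (kernelDomain E))
    (hd : ∀ ζ y, ‖ζ‖ = 1 → ‖y‖ < 1 → HasFDerivAt (F ζ) (F' ζ y) y) (hz : Continuous z)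
    (hz1 : ∀ p, ‖z p‖ = 1) (hg : Integrable g ν) {y : E} (hy : ‖y‖ < 1) :
    HasFDerivAt (fun y => ∫ p, g p • F (z p) y ∂ν) (∫ p, g p • F' (z p) y ∂ν) y := by
  obtain ⟨r, hr, hmem⟩ := exists_closedBall_mem_nhds hy
  obtain ⟨C, hC⟩ := exists_kernel_bound hF' hr
  refine hasFDerivAt_integral_of_dominated_of_fderiv_le (𝕜 := ℝ) (F := fun y p => g p • F (z p) y)
    (F' := fun y p => g p • F' (z p) y) hmem ?_
    (integrable_kernel hF hz hz1 hg hy)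
    (integrable_kernel hF' hz hz1 hg hy).aestronglyMeasurable
    (bound := fun p => ‖g p‖ * C) (ae_of_all _ fun p w hw => ?_) (hg.norm.mul_const C)
    (ae_of_all _ fun p w hw => ?_)
  · filter_upwards [hmem] with w hw
    have hw' : ‖w‖ ≤ r := by simpa using hw
    exact (integrable_kernel hF hz hz1 hg (hw'.trans_lt hr)).aestronglyMeasurable
  · have hw' : ‖w‖ ≤ r := by simpa using hw
    rw [norm_smul]
    exact mul_le_mul_of_nonneg_left (hC _ _ (hz1 p) hw') (norm_nonneg _)
  · have hw' : ‖w‖ ≤ r := by simpa using hw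
    exact (hd _ _ (hz1 p) (hw'.trans_lt hr)).const_smul (g p)

lemma continuousAt_integral_kernel {F : E → E → G}
    (hF : ContinuousOn (fun q : E × E => F q.1 q.2) (kernelDomain E)) (hz : Continuous z)
    (hz1 : ∀ p, ‖z p‖ = 1) (hg : Integrable g ν) {y : E} (hy : ‖y‖ < 1) :
    ContinuousAt (fun y => ∫ p, g p • F (z p) y ∂ν) y := by
  obtain ⟨r, hr, hmem⟩ := exists_closedBall_mem_nhds hy
  obtain ⟨C, hC⟩ := exists_kernel_bound hF hr
  refine continuousAt_of_dominated (bound := fun p => ‖g p‖ * C) ?_ ?_ (hg.norm.mul_const C)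
    (ae_of_all _ fun p => ?_)
  · filter_upwards [hmem] with w hw
    have hw' : ‖w‖ ≤ r := by simpa using hw
    exact (integrable_kernel hF hz hz1 hg (hw'.trans_lt hr)).aestronglyMeasurable
  · filter_upwards [hmem] with w hw
    refine ae_of_all _ fun p => ?_
    have hw' : ‖w‖ ≤ r := by simpa using hw
    rw [norm_smul]
    exact mul_le_mul_of_nonneg_left (hC _ _ (hz1 p) hw') (norm_nonneg _)
  · refine ContinuousAt.const_smul ?_ (g p)
    have h1 : ContinuousOn (fun w => F (z p) w) (Metric.ball 0 1) :=
      hF.comp (f := fun w => (z p, w)) (by fun_prop)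
        fun w hw => ⟨by simpa using hz1 p, hw⟩
    exact h1.continuousAt (Metric.isOpen_ball.mem_nhds (by simpa using hy))

/-- The integral of the Poisson kernel against a density on a parameter space of the sphere. -/
noncomputable def poissonIntegral (ν : Measure (ℝ × ℝ)) (z : ℝ × ℝ → E) (g : ℝ × ℝ → ℝ) (y : E) :
    ℝ :=
  ∫ p, g p • ballPoisson (z p) y ∂ν

lemma hasFDerivAt_poissonIntegral (hz : Continuous z) (hz1 : ∀ p, ‖z p‖ = 1)
    (hg : Integrable g ν) {y : E} (hy : ‖y‖ < 1) :
    HasFDerivAt (poissonIntegral ν z g) (∫ p, g p • ballPoissonDeriv (z p) y ∂ν) y :=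
  hasFDerivAt_integral_kernel continuousOn_ballPoisson continuousOn_ballPoissonDeriv
    (fun _ _ h1 h2 => hasFDerivAt_ballPoisson (sub_ne_zero_of_sphere h1 h2)) hz hz1 hg hy

lemma hasFDerivAt_integral_ballPoissonDeriv (hz : Continuous z) (hz1 : ∀ p, ‖z p‖ = 1)
    (hg : Integrable g ν) {y : E} (hy : ‖y‖ < 1) :
    HasFDerivAt (fun y => ∫ p, g p • ballPoissonDeriv (z p) y ∂ν)
      (∫ p, g p • ballPoissonDeriv2 (z p) y ∂ν) y :=
  hasFDerivAt_integral_kernel continuousOn_ballPoissonDeriv continuousOn_ballPoissonDeriv2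
    (fun _ _ h1 h2 => hasFDerivAt_ballPoissonDeriv (sub_ne_zero_of_sphere h1 h2)) hz hz1 hg hy

lemma fderiv_poissonIntegral_apply (hz : Continuous z) (hz1 : ∀ p, ‖z p‖ = 1)
    (hg : Integrable g ν) {y : E} (hy : ‖y‖ < 1) (v : E) :
    fderiv ℝ (poissonIntegral ν z g) y v = ∫ p, g p * ballPoissonDeriv (z p) y v ∂ν := by
  rw [(hasFDerivAt_poissonIntegral hz hz1 hg hy).fderiv, ContinuousLinearMap.integral_apply
    (integrable_kernel continuousOn_ballPoissonDeriv hz hz1 hg hy)]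
  rfl

lemma fderiv_poissonIntegral_eventuallyEq (hz : Continuous z) (hz1 : ∀ p, ‖z p‖ = 1)
    (hg : Integrable g ν) {y : E} (hy : ‖y‖ < 1) :
    fderiv ℝ (poissonIntegral ν z g) =ᶠ[nhds y]
      fun y => ∫ p, g p • ballPoissonDeriv (z p) y ∂ν := by
  filter_upwards [Metric.isOpen_ball.mem_nhds (show y ∈ Metric.ball (0 : E) 1 by simpa using hy)]
    with w hw
  exact (hasFDerivAt_poissonIntegral hz hz1 hg (by simpa using hw)).fderiv

lemma contDiffAt_poissonIntegral (hz : Continuous z) (hz1 : ∀ p, ‖z p‖ = 1)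
    (hg : Integrable g ν) {y : E} (hy : ‖y‖ < 1) :
    ContDiffAt ℝ 2 (poissonIntegral ν z g) y := by
  have hball : IsOpen (Metric.ball (0 : E) 1) := Metric.isOpen_ball
  refine ContDiffOn.contDiffAt (s := Metric.ball 0 1) ?_ (hball.mem_nhds (by simpa using hy))
  have hfd : ∀ w ∈ Metric.ball (0 : E) 1, HasFDerivAt (fderiv ℝ (poissonIntegral ν z g))
      (∫ p, g p • ballPoissonDeriv2 (z p) w ∂ν) w := fun w hw =>
    (hasFDerivAt_integral_ballPoissonDeriv hz hz1 hg (by simpa using hw)).congr_of_eventuallyEq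
      (fderiv_poissonIntegral_eventuallyEq hz hz1 hg (by simpa using hw))
  rw [show (2 : WithTop ℕ∞) = 1 + 1 by norm_num, contDiffOn_succ_iff_fderiv_of_isOpen hball]
  refine ⟨fun w hw => (hasFDerivAt_poissonIntegral hz hz1 hg
    (by simpa using hw)).differentiableAt.differentiableWithinAt, by simp, ?_⟩
  rw [show (1 : WithTop ℕ∞) = 0 + 1 by norm_num, contDiffOn_succ_iff_fderiv_of_isOpen hball]
  refine ⟨fun w hw => (hfd w hw).differentiableAt.differentiableWithinAt, by simp, ?_⟩
  rw [contDiffOn_zero]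
  refine ContinuousOn.congr (f := fun w => ∫ p, g p • ballPoissonDeriv2 (z p) w ∂ν)
    (fun w hw => ?_) fun w hw => (hfd w hw).fderiv
  exact (continuousAt_integral_kernel continuousOn_ballPoissonDeriv2 hz hz1 hg
    (by simpa using hw)).continuousWithinAt

lemma laplacian_eq_sum_fderiv_fderiv (b : OrthonormalBasis (Fin 3) ℝ E) (f : E → ℝ) (y : E) :
    Laplacian.laplacian f y = ∑ i, fderiv ℝ (fderiv ℝ f) y (b i) (b i) := by
  rw [laplacian_eq_iteratedFDeriv_orthonormalBasis f b]
  simp [iteratedFDeriv_two_apply]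

lemma harmonicOnNhd_poissonIntegral (b : OrthonormalBasis (Fin 3) ℝ E) (hz : Continuous z)
    (hz1 : ∀ p, ‖z p‖ = 1) (hg : Integrable g ν) :
    HarmonicOnNhd (poissonIntegral ν z g) (Metric.ball 0 1) := by
  intro y hy
  refine ⟨contDiffAt_poissonIntegral hz hz1 hg (by simpa using hy), ?_⟩
  filter_upwards [Metric.isOpen_ball.mem_nhds hy] with w hw
  have hw' : ‖w‖ < 1 := by simpa using hw
  have hfd := (hasFDerivAt_integral_ballPoissonDeriv hz hz1 hg hw').congr_of_eventuallyEq
    (fderiv_poissonIntegral_eventuallyEq hz hz1 hg hw')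
  have hI := integrable_kernel (F := ballPoissonDeriv2) continuousOn_ballPoissonDeriv2 hz hz1 hg hw'
  rw [laplacian_eq_sum_fderiv_fderiv b, hfd.fderiv]
  have e : ∀ i, (∫ p, g p • ballPoissonDeriv2 (z p) w ∂ν) (b i) (b i) =
      ∫ p, g p * ballPoissonDeriv2 (z p) w (b i) (b i) ∂ν := by
    intro i
    rw [ContinuousLinearMap.integral_apply hI,
      ContinuousLinearMap.integral_apply (hI.apply_continuousLinearMap _)]
    rfl
  simp only [e, Pi.zero_apply]
  have hI' : ∀ i ∈ Finset.univ, Integrable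
      (fun p => g p * ballPoissonDeriv2 (z p) w (b i) (b i)) ν := fun i _ =>
    (hI.apply_continuousLinearMap (b i)).apply_continuousLinearMap (b i)
  rw [← integral_finsetSum _ hI']
  simp only [← Finset.mul_sum, sum_ballPoissonDeriv2 b (hz1 _) hw', mul_zero, integral_zero]

end KernelIntegrals

/-! ### Spherical angles and rotation invariance of means of zonal functions. -/

/-- The rectangle of polar and azimuthal angles. -/
def angleRect : Set (ℝ × ℝ) := Ioc 0 π ×ˢ Ioc (-π) π

/-- Lebesgue measure on the rectangle of angles. -/
noncomputable def angleMeasure : Measure (ℝ × ℝ) := volume.restrict angleRect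

lemma angleMeasure_eq_prod : angleMeasure =
    ((volume : Measure ℝ).restrict (Ioc 0 π)).prod ((volume : Measure ℝ).restrict (Ioc (-π) π)) := by
  rw [angleMeasure, angleRect, Measure.volume_eq_prod, Measure.prod_restrict]

instance : IsFiniteMeasure angleMeasure := by
  rw [angleMeasure_eq_prod]; infer_instance

lemma ae_mem_angleRect : ∀ᵐ p ∂angleMeasure, p ∈ angleRect :=
  ae_restrict_mem (measurableSet_Ioc.prod measurableSet_Ioc)

lemma neg_pi_le_pi : -π ≤ π := by linarith [pi_pos]

lemma integrable_angleMeasure {G : Type*} [NormedAddCommGroup G] {f : ℝ × ℝ → G}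
    (hf : Continuous f) : Integrable f angleMeasure := by
  have h : IntegrableOn f angleRect volume :=
    (hf.continuousOn.integrableOn_compact (isCompact_Icc.prod isCompact_Icc)).mono_set
      (prod_mono Ioc_subset_Icc_self Ioc_subset_Icc_self)
  exact h

lemma integral_angleMeasure {f : ℝ × ℝ → ℝ} (hf : Continuous f) :
    ∫ p, f p ∂angleMeasure = ∫ θ in (0:ℝ)..π, ∫ ψ in (-π)..π, f (θ, ψ) := by
  have h := integrable_angleMeasure hf
  rw [angleMeasure_eq_prod] at h ⊢
  rw [integral_prod _ h, intervalIntegral.integral_of_le pi_pos.le]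
  simp only [intervalIntegral.integral_of_le neg_pi_le_pi]

lemma integral_angleMeasure_symm {f : ℝ × ℝ → ℝ} (hf : Continuous f) :
    ∫ p, f p ∂angleMeasure = ∫ ψ in (-π)..π, ∫ θ in (0:ℝ)..π, f (θ, ψ) := by
  have h := integrable_angleMeasure hf
  rw [angleMeasure_eq_prod] at h ⊢
  rw [integral_prod_symm _ h, intervalIntegral.integral_of_le neg_pi_le_pi]
  simp only [intervalIntegral.integral_of_le pi_pos.le]

lemma integral_angleMeasure_sin_mul {f : ℝ × ℝ → ℝ} (hf : Continuous f) :
    ∫ p : ℝ × ℝ, sin p.1 * f p ∂angleMeasure =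
      ∫ θ in (0:ℝ)..π, ∫ ψ in (-π)..π, sin θ * f (θ, ψ) :=
  integral_angleMeasure (f := fun p => sin p.1 * f p) (Continuous.mul (by fun_prop) hf)

section Rotation

variable {f f' : ℝ → ℝ} {ρ : ℝ}

lemma rotated_height_mem (hρ : 0 ≤ ρ) (t : ℝ) (p : ℝ × ℝ) :
    ρ * (cos t * cos p.1 + sin t * (sin p.1 * cos p.2)) ∈ Icc (-ρ) ρ := by
  have h : (cos t * cos p.1 + sin t * (sin p.1 * cos p.2)) ^ 2 ≤ 1 := by
    have h1 := sin_sq_add_cos_sq t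
    have h2 := sin_sq_add_cos_sq p.1
    have h3 := sin_sq_add_cos_sq p.2
    have e : 1 - (cos t * cos p.1 + sin t * (sin p.1 * cos p.2)) ^ 2 =
        (cos t * (sin p.1 * cos p.2) - sin t * cos p.1) ^ 2 + (sin p.1 * sin p.2) ^ 2 := by
      have h4 : (sin p.1 * cos p.2) ^ 2 = sin p.1 ^ 2 - (sin p.1 * sin p.2) ^ 2 := by
        linear_combination (sin p.1 ^ 2) * h3
      linear_combination -(h1) * (cos p.1 ^ 2 + (sin p.1 * cos p.2) ^ 2) - h2 - h4
    nlinarith [sq_nonneg (cos t * (sin p.1 * cos p.2) - sin t * cos p.1),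
      sq_nonneg (sin p.1 * sin p.2)]
  have h2 := abs_le_of_sq_le_sq' (h.trans_eq (one_pow 2).symm) zero_le_one
  constructor <;> nlinarith [h2.1, h2.2]

lemma continuous_comp_rotated_height (hρ : 0 ≤ ρ) {h : ℝ → ℝ} (hh : ContinuousOn h (Icc (-ρ) ρ))
    (t : ℝ) : Continuous fun p : ℝ × ℝ =>
      h (ρ * (cos t * cos p.1 + sin t * (sin p.1 * cos p.2))) :=
  hh.comp_continuous (by fun_prop) fun p => rotated_height_mem hρ t p

/-- The infinitesimal rotation of a zonal function has mean zero on the sphere. -/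
lemma integral_rotation_deriv (hρ : 0 ≤ ρ) (hf : ∀ x ∈ Icc (-ρ) ρ, HasDerivAt f (f' x) x)
    (hf' : ContinuousOn f' (Icc (-ρ) ρ)) (t : ℝ) :
    ∫ p : ℝ × ℝ, sin p.1 * (f' (ρ * (cos t * cos p.1 + sin t * (sin p.1 * cos p.2))) *
      (ρ * (-sin t * cos p.1 + cos t * (sin p.1 * cos p.2)))) ∂angleMeasure = 0 := by
  have hfc : ContinuousOn f (Icc (-ρ) ρ) := fun x hx => (hf x hx).continuousAt.continuousWithinAt
  have hc := continuous_comp_rotated_height hρ hfc t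
  have hc' := continuous_comp_rotated_height hρ hf' t
  set H : ℝ × ℝ → ℝ := fun p => ρ * (cos t * cos p.1 + sin t * (sin p.1 * cos p.2)) with hH
  -- In coordinates the rotation field is a divergence: `U = ∂_ψ (cos θ sin ψ f)` and `V = ∂_θ (cos
  -- ψ sin θ f)`. Both integrate to zero, because `sin ψ` vanishes at `±π` and `sin θ` at `0` and
  -- `π`.
  let U : ℝ × ℝ → ℝ := fun p => cos p.1 * (cos p.2 * f (H p) +
    sin p.2 * (f' (H p) * (ρ * (sin t * (sin p.1 * -sin p.2)))))
  let V : ℝ × ℝ → ℝ := fun p => cos p.2 * (cos p.1 * f (H p) +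
    sin p.1 * (f' (H p) * (ρ * (cos t * -sin p.1 + sin t * (cos p.1 * cos p.2)))))
  have hUc : Continuous U := Continuous.mul (by fun_prop) (Continuous.add (Continuous.mul (by fun_prop) hc)
    (Continuous.mul (by fun_prop) (hc'.mul (by fun_prop))))
  have hVc : Continuous V := Continuous.mul (by fun_prop) (Continuous.add (Continuous.mul (by fun_prop) hc)
    (Continuous.mul (by fun_prop) (hc'.mul (by fun_prop))))
  have hsplit : ∀ p : ℝ × ℝ, sin p.1 * (f' (H p) *
      (ρ * (-sin t * cos p.1 + cos t * (sin p.1 * cos p.2)))) = U p - V p := by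
    intro p
    have h3 := sin_sq_add_cos_sq p.2
    simp only [U, V]
    linear_combination (f' (H p) * ρ * sin p.1 * sin t * cos p.1) * h3
  have hU : ∫ p, U p ∂angleMeasure = 0 := by
    rw [integral_angleMeasure hUc]
    refine (intervalIntegral.integral_congr (g := fun _ => 0) fun θ _ => ?_).trans (by simp)
    have hder : ∀ ψ, HasDerivAt (fun ψ => cos θ * (sin ψ * f (H (θ, ψ)))) (U (θ, ψ)) ψ := by
      intro ψ
      have h1 : HasDerivAt (fun ψ => H (θ, ψ)) (ρ * (sin t * (sin θ * -sin ψ))) ψ :=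
        ((((hasDerivAt_cos ψ).const_mul (sin θ)).const_mul (sin t)).const_add
          (cos t * cos θ)).const_mul ρ
      exact ((hasDerivAt_sin ψ).mul ((hf _ (rotated_height_mem hρ t (θ, ψ))).comp ψ h1)).const_mul _
    simp only
    rw [intervalIntegral.integral_eq_sub_of_hasDerivAt (fun ψ _ => hder ψ)
      ((hUc.comp (by fun_prop : Continuous fun ψ : ℝ => (θ, ψ))).intervalIntegrable _ _)]
    simp
  have hV : ∫ p, V p ∂angleMeasure = 0 := by
    rw [integral_angleMeasure_symm hVc]
    refine (intervalIntegral.integral_congr (g := fun _ => 0) fun ψ _ => ?_).trans (by simp)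
    have hder : ∀ θ, HasDerivAt (fun θ => cos ψ * (sin θ * f (H (θ, ψ)))) (V (θ, ψ)) θ := by
      intro θ
      have h1 : HasDerivAt (fun θ => H (θ, ψ))
          (ρ * (cos t * -sin θ + sin t * (cos θ * cos ψ))) θ :=
        (((hasDerivAt_cos θ).const_mul (cos t)).add
          (((hasDerivAt_sin θ).mul_const (cos ψ)).const_mul (sin t))).const_mul ρ
      exact ((hasDerivAt_sin θ).mul ((hf _ (rotated_height_mem hρ t (θ, ψ))).comp θ h1)).const_mul _
    simp only
    rw [intervalIntegral.integral_eq_sub_of_hasDerivAt (fun θ _ => hder θ)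
      ((hVc.comp (by fun_prop : Continuous fun θ : ℝ => (θ, ψ))).intervalIntegrable _ _)]
    simp
  rw [integral_congr_ae (ae_of_all _ hsplit), MeasureTheory.integral_sub (integrable_angleMeasure hUc) (integrable_angleMeasure hVc), hU,
    hV, sub_zero]

/-- The mean of a zonal function on the sphere does not depend on its axis. -/
lemma integral_rotated_zonal (hρ : 0 ≤ ρ) (hf : ∀ x ∈ Icc (-ρ) ρ, HasDerivAt f (f' x) x)
    (hf' : ContinuousOn f' (Icc (-ρ) ρ)) (t : ℝ) :
    ∫ p : ℝ × ℝ, sin p.1 * f (ρ * (cos t * cos p.1 + sin t * (sin p.1 * cos p.2))) ∂angleMeasure =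
      ∫ p : ℝ × ℝ, sin p.1 * f (ρ * cos p.1) ∂angleMeasure := by
  have hfc : ContinuousOn f (Icc (-ρ) ρ) := fun x hx => (hf x hx).continuousAt.continuousWithinAt
  obtain ⟨C, hC⟩ := isCompact_Icc.exists_bound_of_continuousOn hf'
  have hcont : ∀ t, Continuous fun p : ℝ × ℝ =>
      sin p.1 * f (ρ * (cos t * cos p.1 + sin t * (sin p.1 * cos p.2))) := fun t =>
    Continuous.mul (by fun_prop) (continuous_comp_rotated_height hρ hfc t)
  have hder : ∀ t, HasDerivAt (fun t => ∫ p : ℝ × ℝ,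
      sin p.1 * f (ρ * (cos t * cos p.1 + sin t * (sin p.1 * cos p.2))) ∂angleMeasure) 0 t := by
    intro t
    rw [← integral_rotation_deriv hρ hf hf' t]
    refine (hasDerivAt_integral_of_dominated_loc_of_deriv_le
      (F := fun t (p : ℝ × ℝ) =>
        sin p.1 * f (ρ * (cos t * cos p.1 + sin t * (sin p.1 * cos p.2))))
      (F' := fun t (p : ℝ × ℝ) =>
        sin p.1 * (f' (ρ * (cos t * cos p.1 + sin t * (sin p.1 * cos p.2))) *
          (ρ * (-sin t * cos p.1 + cos t * (sin p.1 * cos p.2)))))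
      (bound := fun _ => C * (ρ * 2)) Filter.univ_mem
      (Filter.Eventually.of_forall fun t => (hcont t).aestronglyMeasurable)
      (integrable_angleMeasure (hcont t)) ?_ (ae_of_all _ fun p t _ => ?_) (integrable_const _)
      (ae_of_all _ fun p t _ => ?_)).2
    · exact Continuous.aestronglyMeasurable (Continuous.mul (by fun_prop)
        ((continuous_comp_rotated_height hρ hf' t).mul (by fun_prop)))
    · have hC0 := (norm_nonneg _).trans (hC _ (rotated_height_mem hρ t p))
      rw [norm_mul, norm_mul, norm_mul, norm_of_nonneg hρ]
      have h1 : ‖-sin t * cos p.1 + cos t * (sin p.1 * cos p.2)‖ ≤ 2 := by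
        refine (norm_add_le _ _).trans ?_
        simp only [norm_mul, norm_neg, norm_eq_abs]
        have a1 := mul_le_one₀ (abs_sin_le_one t) (abs_nonneg _) (abs_cos_le_one p.1)
        have a2 := mul_le_one₀ (abs_sin_le_one p.1) (abs_nonneg _) (abs_cos_le_one p.2)
        have a3 := mul_le_one₀ (abs_cos_le_one t) (by positivity) a2
        linarith
      calc ‖sin p.1‖ * (‖f' _‖ * (ρ * ‖-sin t * cos p.1 + cos t * (sin p.1 * cos p.2)‖))
          ≤ 1 * (C * (ρ * 2)) := by
            gcongr
            · exact abs_sin_le_one _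
            · exact hC _ (rotated_height_mem hρ t p)
        _ = _ := one_mul _
    · have h1 : HasDerivAt (fun t => ρ * (cos t * cos p.1 + sin t * (sin p.1 * cos p.2)))
          (ρ * (-sin t * cos p.1 + cos t * (sin p.1 * cos p.2))) t :=
        (((hasDerivAt_cos t).mul_const _).add ((hasDerivAt_sin t).mul_const _)).const_mul ρ
      exact ((hf _ (rotated_height_mem hρ t p)).comp t h1).const_mul _
  have := is_const_of_deriv_eq_zero (fun t => (hder t).differentiableAt) (fun t => (hder t).deriv)
    t 0
  simpa using this

end Rotation

lemma exists_polar (a b : ℝ) : ∃ r α : ℝ, 0 ≤ r ∧ r ^ 2 = a ^ 2 + b ^ 2 ∧ a = r * cos α ∧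
    b = r * sin α := by
  refine ⟨‖(⟨a, b⟩ : ℂ)‖, Complex.arg ⟨a, b⟩, norm_nonneg _, ?_, ?_, ?_⟩
  · rw [Complex.sq_norm, Complex.normSq_mk]; ring
  · rw [Complex.norm_mul_cos_arg]
  · rw [Complex.norm_mul_sin_arg]

lemma integral_cos_sub (h : ℝ → ℝ) (α : ℝ) :
    ∫ ψ in (-π)..π, h (cos (ψ - α)) = ∫ ψ in (-π)..π, h (cos ψ) := by
  rw [intervalIntegral.integral_comp_sub_right (fun ψ => h (cos ψ))]
  have hp : Function.Periodic (fun ψ => h (cos ψ)) (2 * π) := fun ψ => by simp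
  have := hp.intervalIntegral_add_eq (-π - α) (-π)
  rw [show -π - α + 2 * π = π - α by ring, show -π + 2 * π = π by ring] at this
  exact this

/-- Two successive polar decompositions write `(a, b, c)` as a tilt `t` and an azimuth `α`. The
azimuth is removed by periodicity in `ψ`, the tilt by `integral_rotated_zonal`. -/
lemma integral_zonal {f f' : ℝ → ℝ} {ρ a b c : ℝ} (hρ : 0 ≤ ρ) (habc : ρ ^ 2 = a ^ 2 + b ^ 2 + c ^ 2)
    (hf : ∀ x ∈ Icc (-ρ) ρ, HasDerivAt f (f' x) x) (hf' : ContinuousOn f' (Icc (-ρ) ρ)) :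
    ∫ p : ℝ × ℝ, sin p.1 * f (a * cos p.1 + sin p.1 * (b * cos p.2 + c * sin p.2)) ∂angleMeasure =
      2 * π * ∫ θ in (0:ℝ)..π, sin θ * f (ρ * cos θ) := by
  obtain ⟨w, α, hw0, hw, rfl, rfl⟩ := exists_polar b c
  obtain ⟨r, t, hr0, hr, rfl, rfl⟩ := exists_polar a w
  have hrρ : r = ρ := by
    rw [← sq_eq_sq₀ hr0 hρ]; linarith
  subst hrρ
  have hfc : ContinuousOn f (Icc (-r) r) := fun x hx => (hf x hx).continuousAt.continuousWithinAt
  have h1 := integral_rotated_zonal hr0 hf hf' t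
  have hc1 := continuous_comp_rotated_height hr0 hfc t
  have hc0 := continuous_comp_rotated_height hr0 hfc 0
  simp only [cos_zero, sin_zero, one_mul, zero_mul, add_zero] at hc0
  have hshift : ∀ p : ℝ × ℝ, r * cos t * cos p.1 + sin p.1 * (r * sin t * cos α * cos p.2 +
      r * sin t * sin α * sin p.2) =
      r * (cos t * cos p.1 + sin t * (sin p.1 * cos (p.2 - α))) := by
    intro p; rw [cos_sub]; ring
  simp only [hshift]
  have hcs := hc1.comp (by fun_prop : Continuous fun p : ℝ × ℝ => (p.1, p.2 - α))
  simp only [Function.comp_def] at hcs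
  rw [integral_angleMeasure_sin_mul hcs]
  rw [integral_angleMeasure_sin_mul hc1, integral_angleMeasure_sin_mul hc0] at h1
  have h2 : ∀ θ, ∫ ψ in (-π)..π,
      sin θ * f (r * (cos t * cos θ + sin t * (sin θ * cos (ψ - α)))) =
      ∫ ψ in (-π)..π, sin θ * f (r * (cos t * cos θ + sin t * (sin θ * cos ψ))) := fun θ =>
    integral_cos_sub (fun x => sin θ * f (r * (cos t * cos θ + sin t * (sin θ * x)))) α
  simp only [h2, h1, intervalIntegral.integral_const, smul_eq_mul]
  rw [intervalIntegral.integral_const_mul]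
  ring

/-! ### The maximum principle for harmonic functions. -/

section MaximumPrinciple

/-- If `c > 0`, the second derivative test makes `x` a local minimum as well, so `φ` is locally
constant and `c = 0`. -/
lemma nonpos_of_isLocalMax_of_hasDerivAt_deriv {φ : ℝ → ℝ} {c x : ℝ} (hmax : IsLocalMax φ x)
    (hc : ContinuousAt φ x) (h : HasDerivAt (deriv φ) c x) : c ≤ 0 := by
  by_contra! hpos
  have hmin := isLocalMin_of_deriv_deriv_pos (by rw [h.deriv]; exact hpos) hmax.deriv_eq_zero hc
  have hconst : φ =ᶠ[nhds x] fun _ => φ x := by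
    filter_upwards [hmax, hmin] with y h1 h2 using le_antisymm h1 h2
  have hd : deriv φ =ᶠ[nhds x] fun _ => 0 := by
    filter_upwards [hconst.eventuallyEq_nhds] with y hy
    rw [hy.deriv_eq, deriv_const]
  have := h.unique ((hasDerivAt_const x (0:ℝ)).congr_of_eventuallyEq hd)
  linarith

variable {E : Type*} [NormedAddCommGroup E] [InnerProductSpace ℝ E]

lemma fderiv_fderiv_nonpos_of_isLocalMax {w : E → ℝ} {y : E} (hw : ContDiffAt ℝ 2 w y)
    (hmax : IsLocalMax w y) (e : E) : fderiv ℝ (fderiv ℝ w) y e e ≤ 0 := by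
  have hline : ∀ t : ℝ, HasDerivAt (fun t : ℝ => y + t • e) e t := fun t => by
    simpa using ((hasDerivAt_id t).smul_const e).const_add y
  have h0 : y + (0:ℝ) • e = y := by simp
  have hlim : Filter.Tendsto (fun t : ℝ => y + t • e) (nhds 0) (nhds y) := by
    have := (hline 0).continuousAt.tendsto
    rwa [h0] at this
  refine nonpos_of_isLocalMax_of_hasDerivAt_deriv (φ := fun t : ℝ => w (y + t • e)) (x := 0)
    ?_ ?_ ?_
  · have := hlim.eventually hmax
    simpa [IsLocalMax, IsMaxFilter] using this
  · exact ContinuousAt.comp' (by rw [h0]; exact hw.continuousAt) (hline 0).continuousAt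
  · have hev : ∀ᶠ t in nhds (0:ℝ), DifferentiableAt ℝ w (y + t • e) :=
      hlim.eventually ((hw.eventually (by simp)).mono fun z hz => hz.differentiableAt (by simp))
    have hd : deriv (fun t : ℝ => w (y + t • e)) =ᶠ[nhds 0] fun t => fderiv ℝ w (y + t • e) e := by
      filter_upwards [hev] with t ht
      exact (ht.hasFDerivAt.comp_hasDerivAt t (hline t)).deriv
    have h2 : HasFDerivAt (fderiv ℝ w) (fderiv ℝ (fderiv ℝ w) y) y :=
      ((hw.fderiv_right (m := 1) (by norm_num)).differentiableAt (by simp)).hasFDerivAt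
    have h3 : HasFDerivAt (fun z => fderiv ℝ w z e)
        ((ContinuousLinearMap.apply ℝ ℝ e).comp (fderiv ℝ (fderiv ℝ w) y)) (y + (0:ℝ) • e) := by
      rw [h0]
      exact (ContinuousLinearMap.apply ℝ ℝ e).hasFDerivAt.comp y h2
    have h4 := h3.comp_hasDerivAt (0:ℝ) (hline 0)
    exact h4.congr_of_eventuallyEq hd

lemma hasFDerivAt_normSq (y : E) :
    HasFDerivAt (fun y : E => ‖y‖ ^ 2) ((2:ℝ) • innerL y) y := by
  refine (hasFDerivAt_id y).norm_sq.congr_fderiv ?_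
  ext v; simp

variable [FiniteDimensional ℝ E]

lemma laplacian_normSq (b : OrthonormalBasis (Fin 3) ℝ E) (y : E) :
    Laplacian.laplacian (fun y : E => ‖y‖ ^ 2) y = 6 := by
  have h1 : fderiv ℝ (fun y : E => ‖y‖ ^ 2) = fun y => (2:ℝ) • innerL y := by
    ext1 y; exact (hasFDerivAt_normSq y).fderiv
  have h2 : ∀ y : E, HasFDerivAt (fun y : E => (2:ℝ) • innerL y) ((2:ℝ) • innerL) y := fun y =>
    ((2:ℝ) • (innerL : E →L[ℝ] E →L[ℝ] ℝ)).hasFDerivAt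
  rw [laplacian_eq_sum_fderiv_fderiv b, h1, (h2 y).fderiv]
  simp
  norm_num

/-- Adding `η ‖y‖²` makes the Laplacian equal to `6 η > 0`, which excludes an interior maximum; then
`η` is taken arbitrarily small. -/
lemma harmonic_le_of_sphere_le (b : OrthonormalBasis (Fin 3) ℝ E) {v : E → ℝ} {M r : ℝ}
    (hr : r < 1) (hv : HarmonicOnNhd v (Metric.ball 0 1)) (hM : ∀ y, ‖y‖ = r → v y ≤ M) {y : E}
    (hy : ‖y‖ ≤ r) : v y ≤ M := by
  have : ProperSpace E := FiniteDimensional.proper ℝ E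
  have hsub : Metric.closedBall (0 : E) r ⊆ Metric.ball 0 1 := Metric.closedBall_subset_ball hr
  have hr0 : 0 ≤ r := (norm_nonneg y).trans hy
  have key : ∀ η > 0, v y ≤ M + η * r ^ 2 := by
    intro η hη
    have hcont : ContinuousOn (fun y => v y + η * ‖y‖ ^ 2) (Metric.closedBall 0 r) :=
      (hv.continuousOn.mono hsub).add (by fun_prop)
    obtain ⟨y₀, hy₀, hmax⟩ := (isCompact_closedBall (0 : E) r).exists_isMaxOn
      ⟨0, by simpa using hr0⟩ hcont
    have hy₀' : ‖y₀‖ ≤ r := by simpa using hy₀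
    have hle : v y + η * ‖y‖ ^ 2 ≤ v y₀ + η * ‖y₀‖ ^ 2 := hmax (by simpa using hy)
    have hsq : 0 ≤ η * ‖y‖ ^ 2 := by positivity
    rcases hy₀'.eq_or_lt with h | h
    · have := hM y₀ h
      rw [h] at hle
      linarith
    · exfalso
      have hv₀ := hv y₀ (hsub hy₀)
      have hC1 : ContDiffAt ℝ 2 v y₀ := hv₀.1
      have hC2 : ContDiffAt ℝ 2 (fun y : E => ‖y‖ ^ 2) y₀ := contDiffAt_id.norm_sq ℝ
      have hC : ContDiffAt ℝ 2 (v + η • fun y : E => ‖y‖ ^ 2) y₀ := hC1.add (hC2.const_smul η)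
      have hlm : IsLocalMax (v + η • fun y : E => ‖y‖ ^ 2) y₀ := by
        have : Metric.closedBall (0 : E) r ∈ nhds y₀ :=
          Filter.mem_of_superset (Metric.isOpen_ball.mem_nhds (by simpa using h))
            Metric.ball_subset_closedBall
        filter_upwards [this] with z hz using hmax hz
      have hlap : Laplacian.laplacian (v + η • fun y : E => ‖y‖ ^ 2) y₀ = η * 6 := by
        rw [hC1.laplacian_add (f₂ := η • fun y : E => ‖y‖ ^ 2) (hC2.const_smul η), laplacian_smul η hC2, laplacian_normSq b,
          hv₀.2.self_of_nhds]
        simp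
      have hneg : Laplacian.laplacian (v + η • fun y : E => ‖y‖ ^ 2) y₀ ≤ 0 := by
        rw [laplacian_eq_sum_fderiv_fderiv b]
        exact Finset.sum_nonpos fun i _ => fderiv_fderiv_nonpos_of_isLocalMax hC hlm (b i)
      linarith
  refine le_of_forall_pos_le_add fun ε hε => ?_
  have h := key ε hε
  have : ε * r ^ 2 ≤ ε := mul_le_of_le_one_right hε.le (pow_le_one₀ hr0 hr.le)
  linarith

/-- A harmonic function on the ball with vanishing boundary values is zero. -/
lemma harmonic_eq_zero_of_boundary (b : OrthonormalBasis (Fin 3) ℝ E) {v : E → ℝ}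
    (hv : HarmonicOnNhd v (Metric.ball 0 1))
    (hbd : ∀ ε > 0, ∃ r < 1, ∀ y, r ≤ ‖y‖ → ‖y‖ < 1 → |v y| ≤ ε) {y : E} (hy : ‖y‖ < 1) :
    v y = 0 := by
  rw [← abs_nonpos_iff]
  refine le_of_forall_pos_le_add fun ε hε => ?_
  obtain ⟨r, hr, h⟩ := hbd ε hε
  have hs1 : max r ‖y‖ < 1 := max_lt hr hy
  have hs : ∀ w : E, ‖w‖ = max r ‖y‖ → |v w| ≤ ε := fun w hw =>
    h w (hw ▸ le_max_left _ _) (hw ▸ hs1)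
  rw [zero_add, abs_le]
  constructor
  · have := harmonic_le_of_sphere_le b hs1 hv.neg (M := ε)
      (fun w hw => (neg_le_abs _).trans (hs w hw)) (le_max_right r ‖y‖)
    simp only [Pi.neg_apply] at this
    linarith
  · exact harmonic_le_of_sphere_le b hs1 hv (fun w hw => (le_abs_self _).trans (hs w hw))
      (le_max_right r ‖y‖)

end MaximumPrinciple

/-! ### The Poisson formula and the variation of the differentiated kernel. -/

section PoissonFormula

variable {E : Type*} [NormedAddCommGroup E] [InnerProductSpace ℝ E]

/-- Spherical coordinates with respect to an orthonormal basis, the pole being `b 0`. -/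
noncomputable def sphereMap (b : OrthonormalBasis (Fin 3) ℝ E) (p : ℝ × ℝ) : E :=
  cos p.1 • b 0 + (sin p.1 * cos p.2) • b 1 + (sin p.1 * sin p.2) • b 2

/-- The density of normalized area on the sphere in spherical coordinates. -/
noncomputable def areaWeight (p : ℝ × ℝ) : ℝ := sin p.1 / (4 * π)

lemma continuous_areaWeight : Continuous areaWeight := by
  unfold areaWeight; fun_prop

lemma ae_areaWeight_nonneg : ∀ᵐ p ∂angleMeasure, 0 ≤ areaWeight p := by
  filter_upwards [ae_mem_angleRect] with p hp
  have := sin_nonneg_of_nonneg_of_le_pi hp.1.1.le hp.1.2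
  unfold areaWeight
  have := pi_pos
  positivity

variable (b : OrthonormalBasis (Fin 3) ℝ E)

lemma continuous_sphereMap : Continuous (sphereMap b) := by
  unfold sphereMap; fun_prop

lemma inner_sphereMap (y : E) (p : ℝ × ℝ) : inner ℝ y (sphereMap b p) =
    inner ℝ y (b 0) * cos p.1 +
      sin p.1 * (inner ℝ y (b 1) * cos p.2 + inner ℝ y (b 2) * sin p.2) := by
  simp only [sphereMap, inner_add_right, inner_smul_right]
  ring

lemma norm_sq_eq_basis (y : E) :
    ‖y‖ ^ 2 = inner ℝ y (b 0) ^ 2 + inner ℝ y (b 1) ^ 2 + inner ℝ y (b 2) ^ 2 := by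
  rw [← b.sum_sq_norm_inner_left y, Fin.sum_univ_three]
  simp

lemma norm_sphereMap (p : ℝ × ℝ) : ‖sphereMap b p‖ = 1 := by
  have h : ‖sphereMap b p‖ ^ 2 = 1 ^ 2 := by
    have hb := b.orthonormal
    rw [← real_inner_self_eq_norm_sq, inner_sphereMap]
    have e : ∀ i, inner ℝ (sphereMap b p) (b i) = cos p.1 * inner ℝ (b 0) (b i) +
        (sin p.1 * cos p.2) * inner ℝ (b 1) (b i) + (sin p.1 * sin p.2) * inner ℝ (b 2) (b i) :=
      fun i => by simp only [sphereMap, inner_add_left, real_inner_smul_left]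
    simp only [e, b.inner_eq_ite]
    have h1 := sin_sq_add_cos_sq p.1
    have h2 := sin_sq_add_cos_sq p.2
    simp
    linear_combination (sin p.1 ^ 2) * h2 + h1
  rwa [sq_eq_sq₀ (norm_nonneg _) zero_le_one] at h

lemma norm_sub_sphereMap_sq (y : E) (p : ℝ × ℝ) :
    ‖y - sphereMap b p‖ ^ 2 = 1 + ‖y‖ ^ 2 - 2 * inner ℝ y (sphereMap b p) := by
  rw [norm_sub_sq_real, norm_sphereMap]; ring

lemma one_add_sq_sub_pos {ρ x : ℝ} (hρ1 : ρ < 1) (hx : x ≤ ρ) : 0 < 1 + ρ ^ 2 - 2 * x := by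
  nlinarith [mul_pos (sub_pos.2 hρ1) (sub_pos.2 hρ1)]

lemma integral_sin_mul_rpow {ρ : ℝ} (hρ : 0 ≤ ρ) (hρ1 : ρ < 1) :
    ∫ θ in (0:ℝ)..π, sin θ * (1 + ρ ^ 2 - 2 * (ρ * cos θ)) ^ (-(3 / 2) : ℝ) = 2 / (1 - ρ ^ 2) := by
  rcases hρ.eq_or_lt with rfl | hρ
  · simp; norm_num
  have hpos : ∀ θ, 0 < 1 + ρ ^ 2 - 2 * (ρ * cos θ) := fun θ =>
    one_add_sq_sub_pos hρ1 (mul_le_of_le_one_right hρ.le (cos_le_one θ))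
  have hder : ∀ θ, HasDerivAt
      (fun θ => -(1 / ρ) * (1 + ρ ^ 2 - 2 * (ρ * cos θ)) ^ (-(1 / 2) : ℝ))
      (sin θ * (1 + ρ ^ 2 - 2 * (ρ * cos θ)) ^ (-(3 / 2) : ℝ)) θ := by
    intro θ
    have h1 : HasDerivAt (fun θ => 1 + ρ ^ 2 - 2 * (ρ * cos θ)) (-(2 * (ρ * -sin θ))) θ :=
      (((hasDerivAt_cos θ).const_mul ρ).const_mul 2).const_sub _
    refine ((h1.rpow_const (p := -(1 / 2)) (Or.inl (hpos θ).ne')).const_mul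
      (-(1 / ρ))).congr_deriv ?_
    rw [show (-(1 / 2) - 1 : ℝ) = -(3 / 2) by norm_num]
    field_simp
  have hcont : Continuous fun θ =>
      sin θ * (1 + ρ ^ 2 - 2 * (ρ * cos θ)) ^ (-(3 / 2) : ℝ) :=
    continuous_sin.mul (Continuous.rpow_const (by fun_prop) fun θ => Or.inl (hpos θ).ne')
  rw [intervalIntegral.integral_eq_sub_of_hasDerivAt (fun θ _ => hder θ)
    (hcont.intervalIntegrable _ _)]
  have e : ∀ x : ℝ, 0 < x → (x ^ 2) ^ (-(1 / 2) : ℝ) = 1 / x := fun x hx => by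
    rw [← rpow_natCast, ← rpow_mul hx.le]
    norm_num [rpow_neg_one]
  have h1 : 1 + ρ ^ 2 - 2 * (ρ * cos π) = (1 + ρ) ^ 2 := by rw [cos_pi]; ring
  have h2 : 1 + ρ ^ 2 - 2 * (ρ * cos 0) = (1 - ρ) ^ 2 := by rw [cos_zero]; ring
  have h3 : 0 < 1 - ρ := by linarith
  have h4 : 1 - ρ ^ 2 = (1 - ρ) * (1 + ρ) := by ring
  rw [h1, h2, e _ (by linarith), e _ h3, h4]
  field_simp
  ring

lemma ballPoisson_sphereMap (y : E) (p : ℝ × ℝ) : ballPoisson (sphereMap b p) y =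
    (1 - ‖y‖ ^ 2) * (1 + ‖y‖ ^ 2 - 2 * (inner ℝ y (b 0) * cos p.1 +
      sin p.1 * (inner ℝ y (b 1) * cos p.2 + inner ℝ y (b 2) * sin p.2))) ^ (-(3 / 2) : ℝ) := by
  rw [ballPoisson, norm_sub_sphereMap_sq, inner_sphereMap]

lemma integral_areaWeight_ballPoisson {y : E} (hy : ‖y‖ < 1) :
    ∫ p, areaWeight p * ballPoisson (sphereMap b p) y ∂angleMeasure = 1 := by
  have hy0 := norm_nonneg y
  have hne : ∀ x ∈ Icc (-‖y‖) ‖y‖, 1 + ‖y‖ ^ 2 - 2 * x ≠ 0 := fun x hx =>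
    (one_add_sq_sub_pos hy hx.2).ne'
  have h := integral_zonal (f := fun x => (1 + ‖y‖ ^ 2 - 2 * x) ^ (-(3 / 2) : ℝ))
    (f' := fun x => -2 * (-(3 / 2)) * (1 + ‖y‖ ^ 2 - 2 * x) ^ (-(3 / 2) - 1 : ℝ)) hy0
    (norm_sq_eq_basis b y) (fun x hx => by
      have h1 : HasDerivAt (fun x => 1 + ‖y‖ ^ 2 - 2 * x) (-2) x := by
        simpa using ((hasDerivAt_id x).const_mul 2).const_sub (1 + ‖y‖ ^ 2)
      exact h1.rpow_const (Or.inl (hne x hx)))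
    (ContinuousOn.mul (by fun_prop) (ContinuousOn.rpow_const (by fun_prop)
      fun x hx => Or.inl (hne x hx)))
  rw [integral_sin_mul_rpow hy0 hy] at h
  have e : ∀ p : ℝ × ℝ, areaWeight p * ballPoisson (sphereMap b p) y =
      (1 - ‖y‖ ^ 2) / (4 * π) * (sin p.1 * (1 + ‖y‖ ^ 2 - 2 * (inner ℝ y (b 0) * cos p.1 +
      sin p.1 * (inner ℝ y (b 1) * cos p.2 + inner ℝ y (b 2) * sin p.2))) ^ (-(3 / 2) : ℝ)) := by
    intro p
    rw [ballPoisson_sphereMap, areaWeight]; ring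
  simp only [e]
  rw [MeasureTheory.integral_const_mul, h]
  have : 1 - ‖y‖ ^ 2 ≠ 0 := by nlinarith
  have := pi_ne_zero
  field_simp
  norm_num

lemma integral_areaWeight : ∫ p, areaWeight p ∂angleMeasure = 1 := by
  rw [integral_angleMeasure continuous_areaWeight]
  have := pi_ne_zero
  simp only [areaWeight, intervalIntegral.integral_const, smul_eq_mul]
  rw [intervalIntegral.integral_const_mul, intervalIntegral.integral_div, integral_sin]
  simp; field_simp; norm_num

lemma ballPoisson_nonneg {F : Type*} [NormedAddCommGroup F] {ζ y : F} (hy : ‖y‖ < 1) : 0 ≤ ballPoisson ζ y := by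
  have : 0 ≤ 1 - ‖y‖ ^ 2 := by nlinarith [norm_nonneg y]
  unfold ballPoisson
  positivity

lemma ballPoisson_le_of_le {F : Type*} [NormedAddCommGroup F] {ζ y : F} {δ : ℝ} (hδ : 0 < δ) (hy : ‖y‖ < 1) (h : δ ≤ ‖y - ζ‖) :
    ballPoisson ζ y ≤ (1 - ‖y‖ ^ 2) * (δ ^ 2) ^ (-(3 / 2) : ℝ) := by
  have h1 : 0 ≤ 1 - ‖y‖ ^ 2 := by nlinarith [norm_nonneg y]
  unfold ballPoisson
  refine mul_le_mul_of_nonneg_left ?_ h1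
  exact rpow_le_rpow_of_nonpos (by positivity) (by gcongr) (by norm_num)

lemma continuous_ballPoissonDeriv_sphereMap {x : E} (hx : ‖x‖ < 1) (l : E) :
    Continuous fun p => ballPoissonDeriv (sphereMap b p) x l :=
  (continuous_kernel_comp continuousOn_ballPoissonDeriv (continuous_sphereMap b)
    (norm_sphereMap b) hx).clm_apply continuous_const

/-- The kernel has mass one, so the difference is an average of `u y - u ζ`. Near `y` uniform
continuity bounds it by `ε`; at distance at least `δ` the kernel itself is small, because `1 - ‖y‖²`
tends to zero at the boundary. -/
lemma abs_sub_poissonIntegral_le {u : E → ℝ} (hu : ContinuousOn u (Metric.closedBall 0 1))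
    {M : ℝ} (hM : ∀ w, ‖w‖ ≤ 1 → |u w| ≤ M) {ε δ : ℝ} (hδ : 0 < δ) (hε : 0 ≤ ε)
    (hunif : ∀ v w, ‖v‖ ≤ 1 → ‖w‖ ≤ 1 → ‖v - w‖ < δ → |u v - u w| ≤ ε) {y : E} (hy : ‖y‖ < 1) :
    |u y - poissonIntegral angleMeasure (sphereMap b)
      (fun p => areaWeight p * u (sphereMap b p)) y| ≤
      ε + 2 * M * ((1 - ‖y‖ ^ 2) * (δ ^ 2) ^ (-(3 / 2) : ℝ)) := by
  have hz := continuous_sphereMap b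
  have hz1 := norm_sphereMap b
  have huz : Continuous fun p => u (sphereMap b p) :=
    hu.comp_continuous hz fun p => by simp [hz1 p]
  have hP : Continuous fun p => ballPoisson (sphereMap b p) y :=
    continuous_kernel_comp continuousOn_ballPoisson hz hz1 hy
  have hw := continuous_areaWeight
  have hM0 : 0 ≤ M := (abs_nonneg _).trans (hM y hy.le)
  have h1 : 0 ≤ 1 - ‖y‖ ^ 2 := by nlinarith [norm_nonneg y]
  set K := (1 - ‖y‖ ^ 2) * (δ ^ 2) ^ (-(3 / 2) : ℝ) with hK
  have hK0 : 0 ≤ K := by positivity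
  have e : u y - poissonIntegral angleMeasure (sphereMap b)
      (fun p => areaWeight p * u (sphereMap b p)) y =
      ∫ p, areaWeight p * ballPoisson (sphereMap b p) y * (u y - u (sphereMap b p))
        ∂angleMeasure := by
    have e1 : u y = ∫ p, areaWeight p * ballPoisson (sphereMap b p) y * u y ∂angleMeasure := by
      rw [MeasureTheory.integral_mul_const, integral_areaWeight_ballPoisson b hy, one_mul]
    rw [poissonIntegral]
    nth_rw 1 [e1]
    have c1 : Continuous fun p => areaWeight p * ballPoisson (sphereMap b p) y * u y :=
      (hw.mul hP).mul continuous_const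
    have c2 : Continuous fun p =>
        (areaWeight p * u (sphereMap b p)) • ballPoisson (sphereMap b p) y := (hw.mul huz).smul hP
    rw [← MeasureTheory.integral_sub (integrable_angleMeasure c1) (integrable_angleMeasure c2)]
    congr 1; ext p; simp only [smul_eq_mul]; ring
  rw [e, ← norm_eq_abs]
  refine (MeasureTheory.norm_integral_le_integral_norm _).trans ?_
  have hbound : ∀ᵐ p ∂angleMeasure,
      ‖areaWeight p * ballPoisson (sphereMap b p) y * (u y - u (sphereMap b p))‖ ≤
      ε * (areaWeight p * ballPoisson (sphereMap b p) y) + 2 * M * K * areaWeight p := by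
    filter_upwards [ae_areaWeight_nonneg] with p hp
    have hP0 := ballPoisson_nonneg (ζ := sphereMap b p) hy
    rw [norm_mul, norm_mul, norm_of_nonneg hp, norm_of_nonneg hP0, norm_eq_abs]
    rcases lt_or_ge ‖y - sphereMap b p‖ δ with h | h
    · have := hunif _ _ hy.le (hz1 p).le h
      have h3 : areaWeight p * ballPoisson (sphereMap b p) y * |u y - u (sphereMap b p)| ≤
          areaWeight p * ballPoisson (sphereMap b p) y * ε := by gcongr
      have h4 : 0 ≤ 2 * M * K * areaWeight p := by positivity
      linarith
    · have h3 := ballPoisson_le_of_le hδ hy h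
      have h4 : |u y - u (sphereMap b p)| ≤ 2 * M := by
        refine (abs_sub _ _).trans ?_
        linarith [hM y hy.le, hM _ (hz1 p).le]
      have h5 : areaWeight p * ballPoisson (sphereMap b p) y * |u y - u (sphereMap b p)| ≤
          areaWeight p * K * (2 * M) := by gcongr
      have h6 : 0 ≤ ε * (areaWeight p * ballPoisson (sphereMap b p) y) := by positivity
      linarith
  refine (integral_mono_ae
    (integrable_angleMeasure ((hw.mul hP).mul (continuous_const.sub huz))).norm
    (integrable_angleMeasure (by fun_prop)) hbound).trans_eq ?_
  rw [MeasureTheory.integral_add (integrable_angleMeasure (by fun_prop))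
    (integrable_angleMeasure (by fun_prop)), MeasureTheory.integral_const_mul,
    MeasureTheory.integral_const_mul, integral_areaWeight_ballPoisson b hy, integral_areaWeight]
  ring

variable [FiniteDimensional ℝ E]

/-- The Poisson formula for the unit ball of a three-dimensional space. -/
theorem poisson_formula {u : E → ℝ} (hu : HarmonicOnNhd u (Metric.closedBall 0 1)) {y : E}
    (hy : ‖y‖ < 1) : u y = poissonIntegral angleMeasure (sphereMap b)
      (fun p => areaWeight p * u (sphereMap b p)) y := by
  have : ProperSpace E := FiniteDimensional.proper ℝ E
  have hz := continuous_sphereMap b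
  have hz1 := norm_sphereMap b
  have hcomp : IsCompact (Metric.closedBall (0 : E) 1) := isCompact_closedBall _ _
  have huc := hu.continuousOn
  have huz : Continuous fun p => u (sphereMap b p) :=
    huc.comp_continuous hz fun p => by simp [hz1 p]
  have hg : Integrable (fun p => areaWeight p * u (sphereMap b p)) angleMeasure :=
    integrable_angleMeasure (continuous_areaWeight.mul huz)
  have hv := (hu.mono Metric.ball_subset_closedBall).sub (harmonicOnNhd_poissonIntegral b hz hz1 hg)
  refine sub_eq_zero.1 (harmonic_eq_zero_of_boundary b hv (fun ε hε => ?_) hy)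
  obtain ⟨M, hM⟩ := hcomp.exists_bound_of_continuousOn huc
  have hM0 : 0 ≤ M := (norm_nonneg _).trans (hM 0 (by simp))
  obtain ⟨δ, hδ, hunif⟩ := Metric.uniformContinuousOn_iff.1
    (hcomp.uniformContinuousOn_of_continuous huc) (ε / 2) (half_pos hε)
  set c := 2 * M * (δ ^ 2) ^ (-(3 / 2) : ℝ) with hc
  have hc0 : 0 ≤ c := by positivity
  have hlim : Filter.Tendsto (fun r : ℝ => c * (1 - r ^ 2)) (nhdsWithin 1 (Iio 1)) (nhds 0) := by
    have : Continuous fun r : ℝ => c * (1 - r ^ 2) := by fun_prop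
    have h := (this.tendsto 1).mono_left (nhdsWithin_le_nhds (s := Iio 1))
    simpa using h
  obtain ⟨r, hr, hr0, hr1⟩ := ((hlim.eventually (gt_mem_nhds (half_pos hε))).and
    (((eventually_nhdsWithin_of_eventually_nhds (lt_mem_nhds (zero_lt_one (α := ℝ))))).and
    (eventually_mem_nhdsWithin))).exists
  refine ⟨r, hr1, fun w hw hw1 => ?_⟩
  have h := abs_sub_poissonIntegral_le b huc (fun w hw => hM w (by simpa using hw)) hδ
    (half_pos hε).le (fun v w hv hw hvw => by
      have := hunif v (by simpa using hv) w (by simpa using hw) (by rwa [dist_eq_norm])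
      rw [Real.dist_eq] at this
      exact this.le) hw1
  refine h.trans ?_
  have h2 : c * (1 - ‖w‖ ^ 2) ≤ c * (1 - r ^ 2) := by
    have : r ^ 2 ≤ ‖w‖ ^ 2 := by gcongr
    gcongr
  have h3 : 2 * M * ((1 - ‖w‖ ^ 2) * (δ ^ 2) ^ (-(3 / 2) : ℝ)) = c * (1 - ‖w‖ ^ 2) := by
    rw [hc]; ring
  linarith

/-- The total variation of the derivative of the Poisson kernel at `x` in the direction `l`. -/
noncomputable def poissonVariation (x l : E) : ℝ :=
  ∫ p, areaWeight p * |ballPoissonDeriv (sphereMap b p) x l| ∂angleMeasure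

lemma abs_fderiv_le_poissonVariation {u : E → ℝ} (hu : HarmonicOnNhd u (Metric.closedBall 0 1))
    {M : ℝ} (hM : ∀ w, ‖w‖ = 1 → |u w| ≤ M) {x : E} (hx : ‖x‖ < 1) (l : E) :
    |fderiv ℝ u x l| ≤ poissonVariation b x l * M := by
  have hz := continuous_sphereMap b
  have hz1 := norm_sphereMap b
  have huz : Continuous fun p => u (sphereMap b p) :=
    hu.continuousOn.comp_continuous hz fun p => by simp [hz1 p]
  have hw := continuous_areaWeight
  have hg : Integrable (fun p => areaWeight p * u (sphereMap b p)) angleMeasure :=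
    integrable_angleMeasure (continuous_areaWeight.mul huz)
  have hD := continuous_ballPoissonDeriv_sphereMap b hx l
  have heq : u =ᶠ[nhds x] poissonIntegral angleMeasure (sphereMap b)
      (fun p => areaWeight p * u (sphereMap b p)) := by
    filter_upwards [Metric.isOpen_ball.mem_nhds (show x ∈ Metric.ball (0 : E) 1 by simpa using hx)]
      with w hw
    exact poisson_formula b hu (by simpa using hw)
  rw [heq.fderiv_eq, fderiv_poissonIntegral_apply hz hz1 hg hx, poissonVariation,
    ← MeasureTheory.integral_mul_const, ← norm_eq_abs]
  refine (MeasureTheory.norm_integral_le_integral_norm _).trans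
    (integral_mono_ae (integrable_angleMeasure ((hw.mul huz).mul hD)).norm
      (integrable_angleMeasure (by fun_prop)) ?_)
  filter_upwards [ae_areaWeight_nonneg] with p hp
  rw [norm_mul, norm_mul, norm_of_nonneg hp, norm_eq_abs, norm_eq_abs]
  have := hM _ (hz1 p)
  calc areaWeight p * |u (sphereMap b p)| * |ballPoissonDeriv (sphereMap b p) x l|
      ≤ areaWeight p * M * |ballPoissonDeriv (sphereMap b p) x l| := by gcongr
    _ = _ := by ring

end PoissonFormula

/-! ### Dilations, and the upper bound for bounded harmonic functions on the open ball. -/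

section Dilation

variable {E : Type*} [NormedAddCommGroup E] [InnerProductSpace ℝ E] [FiniteDimensional ℝ E]

lemma laplacian_comp_smul (b : OrthonormalBasis (Fin 3) ℝ E) {u : E → ℝ} (r : ℝ) {y : E}
    (hu : ContDiffAt ℝ 2 u (r • y)) :
    Laplacian.laplacian (fun y => u (r • y)) y = r ^ 2 * Laplacian.laplacian u (r • y) := by
  have h1 : fderiv ℝ (fun y => u (r • y)) = fun y => r • fderiv ℝ u (r • y) := by
    ext1 y; exact fderiv_comp_smul r
  have h2 : HasFDerivAt (fderiv ℝ u) (fderiv ℝ (fderiv ℝ u) (r • y)) (r • y) :=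
    ((hu.fderiv_right (m := 1) (by norm_num)).differentiableAt (by simp)).hasFDerivAt
  have h3 : HasFDerivAt (fun y : E => r • y) (r • ContinuousLinearMap.id ℝ E) y :=
    (hasFDerivAt_id y).const_smul r
  have h4 := (h2.comp y h3).const_smul r
  have h5 : fderiv ℝ (fun y => r • fderiv ℝ u (r • y)) y = _ := h4.fderiv
  rw [laplacian_eq_sum_fderiv_fderiv b, laplacian_eq_sum_fderiv_fderiv b, h1, h5, Finset.mul_sum]
  refine Finset.sum_congr rfl fun i _ => ?_
  simp
  ring

lemma HarmonicAt.comp_smul (b : OrthonormalBasis (Fin 3) ℝ E) {u : E → ℝ} {r : ℝ} {y : E}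
    (hu : HarmonicAt u (r • y)) : HarmonicAt (fun y => u (r • y)) y := by
  have hc : Continuous fun y : E => r • y := by fun_prop
  refine ⟨ContDiffAt.comp y hu.1 (by fun_prop), ?_⟩
  filter_upwards [hc.continuousAt.eventually hu.eventually] with w hw
  rw [laplacian_comp_smul b r hw.1, hw.2.self_of_nhds]
  simp

end Dilation

section DirectionalBound

lemma abs_le_supBall {n : ℕ} {u : EuclideanSpace ℝ (Fin n) → ℝ} (hu : IsBoundedHarmonic u)
    {y : EuclideanSpace ℝ (Fin n)} (hy : ‖y‖ < 1) : |u y| ≤ supBall u := by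
  obtain ⟨M, hM⟩ := hu.2
  exact le_ciSup (f := fun y : Metric.ball (0 : EuclideanSpace ℝ (Fin n)) 1 => |u y|)
    ⟨M, by rintro _ ⟨w, rfl⟩; exact hM w w.2⟩ ⟨y, by simpa using hy⟩

/-- A bounded harmonic function on the open ball has no given boundary values, so the Poisson
formula is applied to `y ↦ u (r y)` and then `r → 1`. -/
lemma abs_fderiv_le_poissonVariation_supBall
    (b : OrthonormalBasis (Fin 3) ℝ (EuclideanSpace ℝ (Fin 3)))
    {u : EuclideanSpace ℝ (Fin 3) → ℝ} (hu : IsBoundedHarmonic u) {x : EuclideanSpace ℝ (Fin 3)}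
    (hx : ‖x‖ < 1) (l : EuclideanSpace ℝ (Fin 3)) :
    |fderiv ℝ u x l| ≤ poissonVariation b x l * supBall u := by
  have key : ∀ r ∈ Ioo (0:ℝ) 1,
      |r * fderiv ℝ u (r • x) l| ≤ poissonVariation b x l * supBall u := by
    intro r hr
    have hmem : ∀ w : EuclideanSpace ℝ (Fin 3), ‖w‖ ≤ 1 → ‖r • w‖ < 1 := fun w hw => by
      rw [norm_smul, norm_of_nonneg hr.1.le]
      exact (mul_le_of_le_one_right hr.1.le hw).trans_lt hr.2
    have hh : HarmonicOnNhd (fun y => u (r • y)) (Metric.closedBall 0 1) := fun w hw =>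
      HarmonicAt.comp_smul b (hu.1 _ (by simpa using hmem w (by simpa using hw)))
    have h := abs_fderiv_le_poissonVariation b hh
      (fun w hw => abs_le_supBall hu (hmem w hw.le)) hx l
    have e : fderiv ℝ (fun y => u (r • y)) x = r • fderiv ℝ u (r • x) := fderiv_comp_smul r
    rw [e] at h
    simpa using h
  have hcont : ContinuousAt (fderiv ℝ u) x :=
    (((hu.1 x (by simpa using hx)).1.fderiv_right (m := 1) (by norm_num)).continuousAt)
  have hlim : Filter.Tendsto (fun r : ℝ => |r * fderiv ℝ u (r • x) l|) (nhdsWithin 1 (Iio 1))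
      (nhds |1 * fderiv ℝ u ((1:ℝ) • x) l|) := by
    have h1 : ContinuousAt (fun r : ℝ => fderiv ℝ u (r • x)) 1 :=
      ContinuousAt.comp' (by rwa [one_smul]) (by fun_prop)
    have h2 : ContinuousAt (fun r : ℝ => |r * fderiv ℝ u (r • x) l|) 1 :=
      (continuousAt_id.mul (h1.clm_apply continuousAt_const)).abs
    exact h2.tendsto.mono_left nhdsWithin_le_nhds
  rw [one_mul, one_smul] at hlim
  refine le_of_tendsto hlim ?_
  filter_upwards [Ioo_mem_nhdsLT (zero_lt_one (α := ℝ))] with r hr using key r hr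

end DirectionalBound

/-! ### The variation in the coordinates `(q, ψ)`. -/

section Slices

variable {E : Type*} [NormedAddCommGroup E] [InnerProductSpace ℝ E]
  (b : OrthonormalBasis (Fin 3) ℝ E)

lemma ballPoissonDeriv_apply (ζ y l : E) : ballPoissonDeriv ζ y l =
    -2 * (‖y - ζ‖ ^ 2) ^ (-(3 / 2) : ℝ) * inner ℝ y l -
      3 * (1 - ‖y‖ ^ 2) * (‖y - ζ‖ ^ 2) ^ (-(5 / 2) : ℝ) * inner ℝ (y - ζ) l := by
  simp [ballPoissonDeriv, inner_sub_left]
  ring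

lemma rpow_neg_half_mul {x : ℝ} (hx : 0 < x) (m : ℕ) :
    x ^ (-(m / 2) : ℝ) = 1 / √x ^ m := by
  rw [rpow_neg hx.le, ← rpow_natCast, sqrt_eq_rpow, ← rpow_mul hx.le, one_div]
  congr 2; ring

lemma inner_basis_zero_one : inner ℝ (b 0) (b 0) = 1 ∧ inner ℝ (b 0) (b 1) = 0 ∧
    inner ℝ (b 1) (b 0) = 0 ∧ inner ℝ (b 1) (b 1) = 1 ∧ inner ℝ (b 2) (b 0) = 0 ∧
    inner ℝ (b 2) (b 1) = 0 := by
  simp [b.inner_eq_ite]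

/-- On a parallel circle of the sphere the derivative of the Poisson kernel is a trigonometric
polynomial of degree one. -/
lemma ballPoissonDeriv_slice {ρ : ℝ} (hρ : 0 < ρ) (hρ1 : ρ < 1) (c s : ℝ) {p : ℝ × ℝ}
    (hp : 0 ≤ sin p.1) :
    ballPoissonDeriv (sphereMap b p) (ρ • b 0) (c • b 0 + s • b 1) =
      (-c * axialPart ρ ((1 - ρ ^ 2) / √(1 + ρ ^ 2 - 2 * (ρ * cos p.1))) +
        s * transversalPart ρ ((1 - ρ ^ 2) / √(1 + ρ ^ 2 - 2 * (ρ * cos p.1))) * cos p.2) /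
      (2 * ρ * √(1 + ρ ^ 2 - 2 * (ρ * cos p.1)) ^ 3) := by
  obtain ⟨h00, h01, h10, h11, h20, h21⟩ := inner_basis_zero_one b
  have hnorm : ‖ρ • b 0‖ = ρ := by simp [norm_smul, abs_of_pos hρ]
  have hN : 0 < 1 + ρ ^ 2 - 2 * (ρ * cos p.1) :=
    one_add_sq_sub_pos hρ1 (mul_le_of_le_one_right hρ.le (cos_le_one _))
  have hdist : ‖ρ • b 0 - sphereMap b p‖ ^ 2 = 1 + ρ ^ 2 - 2 * (ρ * cos p.1) := by
    rw [norm_sub_sphereMap_sq, hnorm, inner_sphereMap]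
    simp only [real_inner_smul_left, h00, h01]
    simp [b.inner_eq_ite]
  have hi1 : inner ℝ (ρ • b 0) (c • b 0 + s • b 1) = ρ * c := by
    simp only [inner_add_right, inner_smul_right, real_inner_smul_left, h00, h01]; ring
  have hi2 : inner ℝ (sphereMap b p) (c • b 0 + s • b 1) =
      c * cos p.1 + s * (sin p.1 * cos p.2) := by
    simp only [sphereMap, inner_add_right, inner_add_left, inner_smul_right, real_inner_smul_left,
      h00, h01, h10, h11, h20, h21]
    ring
  rw [ballPoissonDeriv_apply, inner_sub_left, hi1, hi2, hdist, hnorm]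
  set D := √(1 + ρ ^ 2 - 2 * (ρ * cos p.1)) with hD
  have hD0 : 0 < D := sqrt_pos.2 hN
  have hD2 : D ^ 2 = 1 + ρ ^ 2 - 2 * (ρ * cos p.1) := sq_sqrt hN.le
  have h3 := rpow_neg_half_mul hN 3
  have h5 := rpow_neg_half_mul hN 5
  push_cast at h3 h5
  rw [h3, h5, ← hD]
  have hc : cos p.1 = (1 + ρ ^ 2 - D ^ 2) / (2 * ρ) := by
    rw [hD2]; field_simp; ring
  have h1ρ : 0 < 1 - ρ ^ 2 := by nlinarith
  -- At `q = (1 - ρ²) / D` the product under the root is the square of `2 ρ (1 - ρ²) sin θ / D²`;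
  -- its root has the right sign because `sin θ ≥ 0`.
  have ht : transversalPart ρ ((1 - ρ ^ 2) / D) = 3 * (2 * ρ * (1 - ρ ^ 2) * sin p.1 / D ^ 2) := by
    rw [transversalPart]
    congr 1
    rw [← sqrt_sq (show 0 ≤ 2 * ρ * (1 - ρ ^ 2) * sin p.1 / D ^ 2 by positivity)]
    congr 1
    have hs : sin p.1 ^ 2 = 1 - cos p.1 ^ 2 := sin_sq p.1
    rw [div_pow _ (D ^ 2), mul_pow, hs, hc]
    clear_value D
    field_simp
    ring
  rw [ht, axialPart, hc]
  clear_value D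
  field_simp
  ring

/-- Since `dq = -(1 - ρ²) ρ sin θ D⁻³ dθ`, the area weight and the factor `D⁻³` of the slice formula
combine to Lebesgue measure in `q`. -/
lemma poissonVariation_eq_shell {ρ : ℝ} (hρ : 0 < ρ) (hρ1 : ρ < 1) (c s : ℝ) :
    poissonVariation b (ρ • b 0) (c • b 0 + s • b 1) =
      1 / (8 * π * ρ ^ 2 * (1 - ρ ^ 2)) * ∫ q in (1 - ρ)..(1 + ρ), ∫ ψ in (-π)..π,
        |-c * axialPart ρ q + s * transversalPart ρ q * cos ψ| := by
  have hnorm : ‖ρ • b 0‖ < 1 := by simpa [norm_smul, abs_of_pos hρ] using hρ1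
  have hN : ∀ θ, 0 < 1 + ρ ^ 2 - 2 * (ρ * cos θ) := fun θ =>
    one_add_sq_sub_pos hρ1 (mul_le_of_le_one_right hρ.le (cos_le_one θ))
  have h1ρ : 0 < 1 - ρ ^ 2 := by nlinarith
  let f : ℝ → ℝ := fun θ => (1 - ρ ^ 2) / √(1 + ρ ^ 2 - 2 * (ρ * cos θ))
  let f' : ℝ → ℝ := fun θ => -((1 - ρ ^ 2) * ρ * sin θ / √(1 + ρ ^ 2 - 2 * (ρ * cos θ)) ^ 3)
  let g : ℝ → ℝ := fun q => ∫ ψ in (-π)..π,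
    |-c * axialPart ρ q + s * transversalPart ρ q * cos ψ|
  have hf : ∀ θ, HasDerivAt f (f' θ) θ := by
    intro θ
    have h1 : HasDerivAt (fun θ => 1 + ρ ^ 2 - 2 * (ρ * cos θ)) (-(2 * (ρ * -sin θ))) θ :=
      (((hasDerivAt_cos θ).const_mul ρ).const_mul 2).const_sub _
    have hs := (sqrt_pos.2 (hN θ)).ne'
    refine ((hasDerivAt_const θ (1 - ρ ^ 2)).div (h1.sqrt (hN θ).ne') hs).congr_deriv ?_
    simp only [f']
    field_simp
    ring
  have hf'c : Continuous f' :=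
    (Continuous.div (by fun_prop) (by fun_prop)
      fun θ => pow_ne_zero _ (sqrt_pos.2 (hN θ)).ne').neg
  have hgc : Continuous g := by
    have h1 := continuous_axialPart ρ
    have h2 := continuous_transversalPart ρ
    exact continuous_parametric_intervalIntegral_of_continuous'
      (f := fun q ψ => |-c * axialPart ρ q + s * transversalPart ρ q * cos ψ|)
      (by simp only [Function.uncurry_def]; fun_prop) _ _
  have hsub := intervalIntegral.integral_comp_mul_deriv (a := 0) (b := π) (fun θ _ => hf θ)
    hf'c.continuousOn hgc
  have hf0 : f 0 = 1 + ρ := by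
    simp only [f, cos_zero]
    rw [show 1 + ρ ^ 2 - 2 * (ρ * 1) = (1 - ρ) ^ 2 by ring, sqrt_sq (by linarith)]
    have : 1 - ρ ≠ 0 := by linarith
    field_simp; ring
  have hfπ : f π = 1 - ρ := by
    simp only [f, cos_pi]
    rw [show 1 + ρ ^ 2 - 2 * (ρ * -1) = (1 + ρ) ^ 2 by ring, sqrt_sq (by linarith)]
    field_simp; ring
  rw [hf0, hfπ, intervalIntegral.integral_symm (1 - ρ) (1 + ρ)] at hsub
  have hw := continuous_areaWeight
  have hD := continuous_ballPoissonDeriv_sphereMap b hnorm (c • b 0 + s • b 1)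
  have hwD : Continuous fun p => areaWeight p *
      |ballPoissonDeriv (sphereMap b p) (ρ • b 0) (c • b 0 + s • b 1)| := hw.mul hD.abs
  change _ = _ * ∫ q in (1 - ρ)..(1 + ρ), g q
  rw [poissonVariation, integral_angleMeasure hwD, ← neg_eq_iff_eq_neg.2 hsub,
    ← intervalIntegral.integral_neg, ← intervalIntegral.integral_const_mul]
  refine intervalIntegral.integral_congr fun θ hθ => ?_
  rw [uIcc_of_le pi_pos.le] at hθ
  have hsin := sin_nonneg_of_nonneg_of_le_pi hθ.1 hθ.2
  have hs := sqrt_pos.2 (hN θ)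
  have e : ∀ ψ, areaWeight (θ, ψ) *
      |ballPoissonDeriv (sphereMap b (θ, ψ)) (ρ • b 0) (c • b 0 + s • b 1)| =
      sin θ / (4 * π) / (2 * ρ * √(1 + ρ ^ 2 - 2 * (ρ * cos θ)) ^ 3) *
        |-c * axialPart ρ (f θ) + s * transversalPart ρ (f θ) * cos ψ| := by
    intro ψ
    rw [ballPoissonDeriv_slice b hρ hρ1 c s (p := (θ, ψ)) hsin, abs_div,
      abs_of_pos (show 0 < 2 * ρ * √(1 + ρ ^ 2 - 2 * (ρ * cos θ)) ^ 3 by positivity), areaWeight]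
    simp only [f]
    ring
  simp only [e, intervalIntegral.integral_const_mul, Function.comp, f']
  have := pi_pos
  change _ * g (f θ) = _
  field_simp
  ring

lemma integral_sin_mul_abs_cos : ∫ θ in (0:ℝ)..π, sin θ * |cos θ| = 1 := by
  have h := intervalIntegral.integral_comp_mul_deriv (a := 0) (b := π) (g := fun x => |x|)
    (fun θ _ => hasDerivAt_cos θ) (by fun_prop) continuous_abs
  have e : ∫ θ in (0:ℝ)..π, sin θ * |cos θ| =
      -∫ θ in (0:ℝ)..π, ((fun x => |x|) ∘ cos) θ * -sin θ := by
    rw [← intervalIntegral.integral_neg]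
    congr 1; ext θ; simp only [Function.comp]; ring
  rw [e, h, cos_zero, cos_pi, ← intervalIntegral.integral_symm,
    ← integral_add_adjacent_intervals (b := 0) (continuous_abs.intervalIntegrable _ _)
      (continuous_abs.intervalIntegrable _ _)]
  have e1 : ∫ x in (-1:ℝ)..0, |x| = ∫ x in (-1:ℝ)..0, -x :=
    intervalIntegral.integral_congr fun x hx => by
      rw [uIcc_of_le (by norm_num)] at hx
      exact abs_of_nonpos hx.2
  have e2 : ∫ x in (0:ℝ)..1, |x| = ∫ x in (0:ℝ)..1, x :=
    intervalIntegral.integral_congr fun x hx => by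
      rw [uIcc_of_le (by norm_num)] at hx
      exact abs_of_nonneg hx.1
  rw [e1, e2, intervalIntegral.integral_neg, integral_id, integral_id]
  norm_num

/-- At the centre the derivative of the kernel is `3 cos θ`, and the mean of `|cos θ|` over the
sphere is `1/2`. -/
lemma poissonVariation_zero : poissonVariation b 0 (b 0) = 3 / 2 := by
  have hcont : Continuous fun p => areaWeight p *
      |ballPoissonDeriv (sphereMap b p) 0 (b 0)| := continuous_areaWeight.mul
    (continuous_ballPoissonDeriv_sphereMap b (x := (0 : E)) (by simp) (b 0)).abs
  rw [poissonVariation, integral_angleMeasure hcont]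
  obtain ⟨h00, -, h10, -, h20, -⟩ := inner_basis_zero_one b
  have e : ∀ p : ℝ × ℝ, ballPoissonDeriv (sphereMap b p) 0 (b 0) = 3 * cos p.1 := by
    intro p
    rw [ballPoissonDeriv_apply]
    have : inner ℝ (sphereMap b p) (b 0) = cos p.1 := by
      simp only [sphereMap, inner_add_left, real_inner_smul_left, h00, h10, h20]; ring
    simp [norm_sphereMap, this]
  have e2 : ∀ θ ψ : ℝ, areaWeight (θ, ψ) * |3 * cos θ| = 3 / (4 * π) * (sin θ * |cos θ|) := by
    intro θ ψ
    rw [abs_mul, abs_of_pos (three_pos), areaWeight]; ring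
  simp only [e, e2, intervalIntegral.integral_const, smul_eq_mul]
  rw [intervalIntegral.integral_const_mul, intervalIntegral.integral_const_mul,
    integral_sin_mul_abs_cos]
  have := pi_ne_zero
  field_simp
  ring

/-- Identifies the constant with the value of the shell integral in the radial direction, where the
`ψ`-integration only contributes `2 π`. -/
lemma khavinsonConstant_eq {ρ : ℝ} (hρ : 0 < ρ) (hρ1 : ρ < 1) : khavinsonConstant ρ =
    1 / (8 * π * ρ ^ 2 * (1 - ρ ^ 2)) *
      (2 * π * ∫ q in (1 - ρ)..(1 + ρ), |axialPart ρ q|) := by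
  rw [integral_abs_axialPart hρ hρ1, khavinsonConstant, if_neg hρ.ne']
  have h1 : 1 - ρ ^ 2 ≠ 0 := by nlinarith
  have := pi_ne_zero
  field_simp
  ring

lemma poissonVariation_le_khavinsonConstant {ρ : ℝ} (hρ : 0 < ρ) (hρ1 : ρ < 1) {c s : ℝ}
    (hs : 0 ≤ s) (hcs : c ^ 2 + s ^ 2 = 1) :
    poissonVariation b (ρ • b 0) (c • b 0 + s • b 1) ≤ khavinsonConstant ρ := by
  rw [poissonVariation_eq_shell b hρ hρ1, khavinsonConstant_eq hρ hρ1]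
  have h1 : 0 < 1 - ρ ^ 2 := by nlinarith
  have := pi_pos
  refine mul_le_mul_of_nonneg_left ?_ (by positivity)
  exact integral_abs_shell_le hρ hρ1 hs (by rwa [neg_sq])

lemma poissonVariation_radial {ρ : ℝ} (hρ : 0 ≤ ρ) (hρ1 : ρ < 1) :
    poissonVariation b (ρ • b 0) (b 0) = khavinsonConstant ρ := by
  rcases hρ.eq_or_lt with rfl | hρ
  · rw [zero_smul, poissonVariation_zero, khavinsonConstant, if_pos rfl]
  · have h := poissonVariation_eq_shell b hρ hρ1 1 0
    rw [one_smul, zero_smul, add_zero] at h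
    rw [h, khavinsonConstant_eq hρ hρ1, ← intervalIntegral.integral_const_mul (2 * π)]
    congr 1
    refine intervalIntegral.integral_congr (E := ℝ) fun q _ => ?_
    simp only [zero_mul, add_zero, intervalIntegral.integral_const, smul_eq_mul, neg_mul, one_mul,
      abs_neg]
    ring

end Slices

/-! ### Orthonormal frames adapted to a point and a direction. -/

section Frame

variable {E : Type*} [NormedAddCommGroup E] [InnerProductSpace ℝ E]

lemma exists_orthonormalBasis_adapted [FiniteDimensional ℝ E] (hE : Module.finrank ℝ E = 3)
    {e l : E} (he : ‖e‖ = 1) (hl : ‖l‖ = 1) :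
    ∃ (b : OrthonormalBasis (Fin 3) ℝ E) (c s : ℝ),
      b 0 = e ∧ 0 ≤ s ∧ c ^ 2 + s ^ 2 = 1 ∧ l = c • b 0 + s • b 1 := by
  set c : ℝ := inner ℝ e l with hc
  set r : E := l - c • e with hr
  have hee : inner ℝ e e = 1 := by rw [real_inner_self_eq_norm_sq, he, one_pow]
  have her : inner ℝ e r = 0 := by rw [hr, inner_sub_right, inner_smul_right, hee, ← hc]; ring
  have hlr : l = c • e + r := by rw [hr]; abel
  have hcs : c ^ 2 + ‖r‖ ^ 2 = 1 := by
    have h : ‖l‖ ^ 2 = ‖c • e‖ ^ 2 + ‖r‖ ^ 2 := by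
      rw [hlr, norm_add_sq_real, real_inner_smul_left, her]; ring
    rw [hl, norm_smul, he, mul_one, norm_eq_abs, sq_abs, one_pow] at h
    exact h.symm
  have hcard : Module.finrank ℝ E = Fintype.card (Fin 3) := by simpa using hE
  -- When `l` is parallel to `e` there is nothing to normalize: any extension of `e` serves, with `s
  -- = 0`.
  by_cases hr0 : r = 0
  · have hv : Orthonormal ℝ (({0} : Set (Fin 3)).domRestrict fun _ => e) := by
      refine ⟨fun _ => he, fun i j hij => (hij (Subsingleton.elim i j)).elim⟩
    obtain ⟨b, hb⟩ := hv.exists_orthonormalBasis_extension_of_card_eq hcard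
    refine ⟨b, c, ‖r‖, hb 0 rfl, norm_nonneg _, hcs, ?_⟩
    rw [hb 0 rfl, hr0, norm_zero, zero_smul, ← hr0, ← hlr]
  · have hn : ‖r‖ ≠ 0 := norm_ne_zero_iff.2 hr0
    have hf : ‖‖r‖⁻¹ • r‖ = 1 := by rw [norm_smul, norm_inv, norm_norm, inv_mul_cancel₀ hn]
    have hef : inner ℝ e (‖r‖⁻¹ • r) = 0 := by rw [inner_smul_right, her, mul_zero]
    have hv : Orthonormal ℝ
        (({0, 1} : Set (Fin 3)).domRestrict fun i => if i = 0 then e else ‖r‖⁻¹ • r) := by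
      constructor
      · rintro ⟨i, rfl | rfl⟩
        · simpa using he
        · simpa using hf
      · rintro ⟨i, rfl | rfl⟩ ⟨j, rfl | rfl⟩ hij
        · exact (hij rfl).elim
        · simpa using hef
        · simpa [real_inner_comm] using hef
        · exact (hij rfl).elim
    obtain ⟨b, hb⟩ := hv.exists_orthonormalBasis_extension_of_card_eq hcard
    have h0 : b 0 = e := hb 0 (by simp)
    have h1 : b 1 = ‖r‖⁻¹ • r := hb 1 (by simp)
    refine ⟨b, c, ‖r‖, h0, norm_nonneg _, hcs, ?_⟩
    rw [h0, h1, smul_smul, mul_inv_cancel₀ hn, one_smul, ← hlr]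

end Frame

/-! ### Upper bound, extremal functions and sharpness. -/

section Sharp

lemma supBall_nonneg {n : ℕ} (u : EuclideanSpace ℝ (Fin n) → ℝ) : 0 ≤ supBall u :=
  Real.iSup_nonneg fun _ => abs_nonneg _

lemma supBall_le {n : ℕ} {u : EuclideanSpace ℝ (Fin n) → ℝ} {M : ℝ}
    (hM : ∀ y, ‖y‖ < 1 → |u y| ≤ M) : supBall u ≤ M := by
  have : Nonempty (Metric.ball (0 : EuclideanSpace ℝ (Fin n)) 1) := ⟨⟨0, by simp⟩⟩
  exact ciSup_le fun y => hM y (mem_ball_zero_iff.1 y.2)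

lemma isBoundedHarmonic_one {n : ℕ} :
    IsBoundedHarmonic fun _ : EuclideanSpace ℝ (Fin n) => (1 : ℝ) :=
  ⟨fun _ _ => harmonicAt_const _, 1, fun _ _ => by simp⟩

lemma supBall_one {n : ℕ} : supBall (fun _ : EuclideanSpace ℝ (Fin n) => (1 : ℝ)) = 1 :=
  (supBall_le fun _ _ => by simp).antisymm
    (by simpa using abs_le_supBall isBoundedHarmonic_one (y := 0) (by simp))

lemma inner_gradient {n : ℕ} (u : EuclideanSpace ℝ (Fin n) → ℝ) (x l : EuclideanSpace ℝ (Fin n)) :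
    inner ℝ (gradient u x) l = fderiv ℝ u x l := by
  rw [gradient, toDual_symm_apply]

/-- Tested on the constant function `1`. Nonnegativity also allows `c * supBall u ≤ c` when `supBall
u ≤ 1`. -/
lemma nonneg_of_mem_directionalConstants {n : ℕ} {x l : EuclideanSpace ℝ (Fin n)} {c : ℝ}
    (hc : c ∈ directionalConstants x l) : 0 ≤ c := by
  have h := (abs_nonneg _).trans (hc _ isBoundedHarmonic_one)
  rwa [supBall_one, mul_one] at h

lemma gradientConstants_subset {n : ℕ} {x l : EuclideanSpace ℝ (Fin n)} (hl : ‖l‖ = 1) :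
    gradientConstants x ⊆ directionalConstants x l := fun c hc u hu =>
  ((abs_real_inner_le_norm _ _).trans_eq (by rw [hl, mul_one])).trans (hc u hu)

/-- The admissible set is an intersection of closed half-lines and is bounded below by `0`, so its
infimum is attained. -/
lemma isLeast_optimalDirectionalConstant {n : ℕ} {x l : EuclideanSpace ℝ (Fin n)}
    (h : (directionalConstants x l).Nonempty) :
    IsLeast (directionalConstants x l) (optimalDirectionalConstant x l) := by
  have hb : BddBelow (directionalConstants x l) :=
    ⟨0, fun _ hc => nonneg_of_mem_directionalConstants hc⟩
  have hcl : IsClosed (directionalConstants x l) := by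
    simp only [directionalConstants, Set.ofPred_forall]
    exact isClosed_iInter fun u => isClosed_iInter fun _ =>
      isClosed_le continuous_const (by fun_prop)
  exact hcl.isLeast_csInf h hb

lemma abs_fderiv_le_khavinsonConstant {u : EuclideanSpace ℝ (Fin 3) → ℝ}
    (hu : IsBoundedHarmonic u) {x l : EuclideanSpace ℝ (Fin 3)} (hx : ‖x‖ < 1) (hl : ‖l‖ = 1) :
    |fderiv ℝ u x l| ≤ khavinsonConstant ‖x‖ * supBall u := by
  have hE : Module.finrank ℝ (EuclideanSpace ℝ (Fin 3)) = 3 := by simp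
  by_cases h0 : x = 0
  -- At the centre every direction counts as radial: the frame is chosen with `b 0 = l`.
  · subst h0
    obtain ⟨b, -, -, hb, -⟩ := exists_orthonormalBasis_adapted hE hl hl
    have h := abs_fderiv_le_poissonVariation_supBall b hu hx l
    rw [← zero_smul ℝ (b 0), ← hb, poissonVariation_radial b le_rfl zero_lt_one] at h
    simpa [hb] using h
  · have hn := norm_pos_iff.2 h0
    have he : ‖‖x‖⁻¹ • x‖ = 1 := by rw [norm_smul, norm_inv, norm_norm, inv_mul_cancel₀ hn.ne']
    obtain ⟨b, c, s, hb, hs, hcs, rfl⟩ := exists_orthonormalBasis_adapted hE he hl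
    have hxb : x = ‖x‖ • b 0 := by rw [hb, smul_smul, mul_inv_cancel₀ hn.ne', one_smul]
    refine (abs_fderiv_le_poissonVariation_supBall b hu hx _).trans
      (mul_le_mul_of_nonneg_right ?_ (supBall_nonneg u))
    have h := poissonVariation_le_khavinsonConstant b hn hx hs hcs
    rwa [← hxb] at h

/-- The directional bound is uniform in `l`, so it may be applied in the direction of the gradient
itself. -/
lemma norm_gradient_le_khavinsonConstant {u : EuclideanSpace ℝ (Fin 3) → ℝ}
    (hu : IsBoundedHarmonic u) {x : EuclideanSpace ℝ (Fin 3)} (hx : ‖x‖ < 1) :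
    ‖gradient u x‖ ≤ khavinsonConstant ‖x‖ * supBall u := by
  by_cases h0 : gradient u x = 0
  · have h := (abs_nonneg _).trans
      (abs_fderiv_le_khavinsonConstant hu hx (l := EuclideanSpace.single 0 1) (by simp))
    rwa [h0, norm_zero]
  · have hn := norm_ne_zero_iff.2 h0
    have h := abs_fderiv_le_khavinsonConstant hu hx (l := ‖gradient u x‖⁻¹ • gradient u x)
      (by rw [norm_smul, norm_inv, norm_norm, inv_mul_cancel₀ hn])
    rw [← inner_gradient, inner_smul_right, real_inner_self_eq_norm_sq, pow_two, ← mul_assoc,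
      inv_mul_cancel₀ hn, one_mul, abs_norm] at h
    exact h

/-- The Poisson integral of the sign of the kernel's derivative attains the variation. -/
lemma exists_isBoundedHarmonic_fderiv_eq
    (b : OrthonormalBasis (Fin 3) ℝ (EuclideanSpace ℝ (Fin 3))) {x : EuclideanSpace ℝ (Fin 3)}
    (hx : ‖x‖ < 1) (l : EuclideanSpace ℝ (Fin 3)) :
    ∃ u : EuclideanSpace ℝ (Fin 3) → ℝ, IsBoundedHarmonic u ∧ supBall u ≤ 1 ∧
      fderiv ℝ u x l = poissonVariation b x l := by
  have hz := continuous_sphereMap b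
  have hz1 := norm_sphereMap b
  have hD := continuous_ballPoissonDeriv_sphereMap b hx l
  set D : ℝ × ℝ → ℝ := fun p => ballPoissonDeriv (sphereMap b p) x l with hDdef
  -- `D / |D|` is the sign of `D`, with value `0` at the zeros of `D`.
  have hsgn : ∀ t : ℝ, |t / (|t|)| ≤ 1 := fun t => by
    rw [abs_div, abs_abs]; exact div_self_le_one _
  have hwi : Integrable areaWeight angleMeasure := integrable_angleMeasure continuous_areaWeight
  have hm : AEStronglyMeasurable (fun p => D p / |D p|) angleMeasure :=
    (hD.measurable.div hD.abs.measurable).aestronglyMeasurable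
  have hg : Integrable (fun p => areaWeight p * (D p / |D p|)) angleMeasure :=
    (hwi.bdd_mul hm (Filter.Eventually.of_forall fun p => hsgn (D p))).congr
      (Filter.Eventually.of_forall fun p => mul_comm _ _)
  have hbd : ∀ y : EuclideanSpace ℝ (Fin 3), ‖y‖ < 1 → |poissonIntegral angleMeasure (sphereMap b)
      (fun p => areaWeight p * (D p / |D p|)) y| ≤ 1 := by
    intro y hy
    have hwP : Integrable (fun p => areaWeight p * ballPoisson (sphereMap b p) y) angleMeasure :=
      integrable_kernel continuousOn_ballPoisson hz hz1 hwi hy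
    rw [← integral_areaWeight_ballPoisson b hy, poissonIntegral, ← norm_eq_abs]
    refine norm_integral_le_of_norm_le hwP ?_
    filter_upwards [ae_areaWeight_nonneg] with p hp
    have hP := ballPoisson_nonneg (ζ := sphereMap b p) hy
    rw [smul_eq_mul, norm_eq_abs, abs_mul, abs_mul, abs_of_nonneg hp, abs_of_nonneg hP]
    exact mul_le_mul_of_nonneg_right (mul_le_of_le_one_right hp (hsgn _)) hP
  refine ⟨poissonIntegral angleMeasure (sphereMap b) (fun p => areaWeight p * (D p / |D p|)),
    ⟨harmonicOnNhd_poissonIntegral b hz hz1 hg, 1, fun y hy => hbd y (by simpa using hy)⟩,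
    supBall_le hbd, ?_⟩
  rw [fderiv_poissonIntegral_apply hz hz1 hg hx, poissonVariation]
  congr 1; ext p
  change areaWeight p * (D p / |D p|) * D p = areaWeight p * |D p|
  rcases eq_or_ne (D p) 0 with h | h
  · simp [h]
  · have := abs_ne_zero.2 h
    field_simp
    rw [sq_abs]

lemma khavinsonConstant_le_of_mem {b : OrthonormalBasis (Fin 3) ℝ (EuclideanSpace ℝ (Fin 3))}
    {ρ : ℝ} (hρ : 0 ≤ ρ) (hρ1 : ρ < 1) {c : ℝ} (hc : c ∈ directionalConstants (ρ • b 0) (b 0)) :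
    khavinsonConstant ρ ≤ c := by
  have hx : ‖ρ • b 0‖ < 1 := by simpa [norm_smul, abs_of_nonneg hρ] using hρ1
  obtain ⟨u, hu, hu1, hd⟩ := exists_isBoundedHarmonic_fderiv_eq b hx (b 0)
  have h := hc u hu
  rw [inner_gradient, hd, poissonVariation_radial b hρ hρ1] at h
  exact (le_abs_self _).trans (h.trans
    (mul_le_of_le_one_right (nonneg_of_mem_directionalConstants hc) hu1))

end Sharp

theorem theorem2 (x : EuclideanSpace ℝ (Fin 3)) (hx : ‖x‖ < 1) :
    (∀ u : EuclideanSpace ℝ (Fin 3) → ℝ, IsBoundedHarmonic u →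
      ‖gradient u x‖ ≤ khavinsonConstant ‖x‖ * supBall u) ∧
    IsLeast (gradientConstants x) (khavinsonConstant ‖x‖) ∧
    (x ≠ 0 →
      IsLeast (directionalConstants x (radialDirection x)) (khavinsonConstant ‖x‖) ∧
      (∀ l : EuclideanSpace ℝ (Fin 3), ‖l‖ = 1 →
        IsLeast (directionalConstants x l) (optimalDirectionalConstant x l) ∧
        optimalDirectionalConstant x l ≤ optimalDirectionalConstant x (radialDirection x)) ∧
      optimalGradientConstant x = optimalDirectionalConstant x (radialDirection x)) := by
  have hE : Module.finrank ℝ (EuclideanSpace ℝ (Fin 3)) = 3 := by simp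
  have hK : khavinsonConstant ‖x‖ ∈ gradientConstants x :=
    fun u hu => norm_gradient_le_khavinsonConstant hu hx
  -- Stated for any unit `e` with `x = ‖x‖ e`, so that it also covers `x = 0`, where `e` is
  -- arbitrary.
  have hlow : ∀ e : EuclideanSpace ℝ (Fin 3), ‖e‖ = 1 → x = ‖x‖ • e →
      khavinsonConstant ‖x‖ ∈ lowerBounds (directionalConstants x e) := by
    intro e he hxe c hc
    obtain ⟨b, -, -, hb, -⟩ := exists_orthonormalBasis_adapted hE he he
    refine khavinsonConstant_le_of_mem (b := b) (norm_nonneg x) hx ?_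
    rwa [hb, ← hxe]
  have hrad : x ≠ 0 → ‖radialDirection x‖ = 1 ∧ x = ‖x‖ • radialDirection x := by
    intro h0
    have hn := norm_ne_zero_iff.2 h0
    rw [radialDirection, norm_smul, norm_inv, norm_norm, smul_smul, inv_mul_cancel₀ hn,
      mul_inv_cancel₀ hn, one_smul]
    exact ⟨rfl, rfl⟩
  have hgrad : IsLeast (gradientConstants x) (khavinsonConstant ‖x‖) := by
    refine ⟨hK, ?_⟩
    obtain ⟨e, he, hxe⟩ : ∃ e : EuclideanSpace ℝ (Fin 3), ‖e‖ = 1 ∧ x = ‖x‖ • e := by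
      by_cases h0 : x = 0
      · exact ⟨EuclideanSpace.single 0 1, by simp, by simp [h0]⟩
      · exact ⟨_, hrad h0⟩
    exact fun c hc => hlow e he hxe (gradientConstants_subset he hc)
  refine ⟨fun u hu => hK u hu, hgrad, fun h0 => ?_⟩
  obtain ⟨he, hxe⟩ := hrad h0
  have hdir : IsLeast (directionalConstants x (radialDirection x)) (khavinsonConstant ‖x‖) :=
    ⟨gradientConstants_subset he hK, hlow _ he hxe⟩
  have hopt : optimalDirectionalConstant x (radialDirection x) = khavinsonConstant ‖x‖ :=
    hdir.csInf_eq
  refine ⟨hdir, fun l hl => ?_, ?_⟩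
  · have hl' := isLeast_optimalDirectionalConstant ⟨_, gradientConstants_subset hl hK⟩
    exact ⟨hl', hopt ▸ hl'.2 (gradientConstants_subset hl hK)⟩
  · rw [hopt]
    exact hgrad.csInf_eq
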